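/- Let $3\le p\le q$ be integers. Write $\xi_p=\sqrt2\,\sqrt{7-\cos(2\pi/p)}$, $$\rho^*_{p,q}=\Big(\cos\tfrac{\pi}{p}\cos\tfrac{\pi}{q}+\tfrac12\sin\tfrac{\pi}{q}\big(4\sin\tfrac{\pi}{p}+\xi_p\big)\Big)+i\Big(\tfrac{\xi_p}{2}\cos\tfrac{\pi}{q}+\cos\tfrac{\pi}{p}\sin\tfrac{\pi}{q}\Big),$$ $$x_{p,q}=\frac{\cos\big(\tfrac{2\pi}{p}-\tfrac{2\pi}{q}\big)-\cos\tfrac{2\pi}{p}-\cos\tfrac{2\pi}{q}+\xi_p\big(\sin\tfrac{\pi}{p}-\sin(\tfrac{\pi}{p}-\tfrac{2\pi}{q})\big)+5}{\cos\tfrac{\pi}{p}\cos\tfrac{\pi}{q}+\tfrac12\sin\tfrac{\pi}{q}\big(4\sin\tfrac{\pi}{p}+\xi_p\big)},$$ and define $\rho^*_{q,p}$, $x_{q,p}$ by exchanging $p$ and $q$ (so that $\xi_q$ appears). The symmetry of a set is its reflection in the line $\operatorname{Re}z=2\sin\frac{\pi}{p}\sin\frac{\pi}{q}$. Consider the twelve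 lines (with coincidences if $p=q$): 1. the line $\operatorname{Re}z=2+2\cos(\frac{\pi}{p}-\frac{\pi}{q})$ and its symmetry; 2. the two lines $\operatorname{Im}z=\pm2\sqrt{1-\sin^2\frac{\pi}{p}\sin^2\frac{\pi}{q}}$; 3. the line through $\rho^*_{p,q}$ and $x_{p,q}$, its complex conjugate, and the symmetries of both; 4. the line through $\rho^*_{q,p}$ and $x_{q,p}$, its complex conjugate, and the symmetries of both. Let $\Omega_{p,q}$ be the open polygon bounded by these lines, that is, the set of points lying, for each of the twelve lines, strictly on the same side of it as the centre $2\sin\frac{\pi}{p}\sin\frac{\pi}{q}$. **Theorem.** (a) Let $X,Y\in\mathrm{SL}(2,\mathbb C)$ be primitive elliptic elements of orders $p$ and $q$ (i.e. $\operatorname{tr}X=\pm2\cos\frac{\pi}{p}$, $\operatorname{tr}Y=\pm2\cos\frac{\pi}{q}$), and let $\rho\in\mathbb C$ be a solution of $$\rho\Big(\rho-4\sin\frac{\pi}{p}\sin\frac{\pi}{q}\Big)=\operatorname{tr}[X,Y]-2 .$$ If $\rho\notin\Omega_{p,q}$, then the subgroup $\langle X,Y\rangle$ of $\mathrm{PSL}(2,\mathbb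 C)$ is discrete and is the free product $\langle X\rangle*\langle Y\rangle$ of its cyclic subgroups generated by $X$ and $Y$. (b) The bound is sharp at four cusp groups. For $\rho\in\mathbb C$ let $A=\begin{pmatrix}e^{i\pi/p}&1\\0&e^{-i\pi/p}\end{pmatrix}$, $B_\rho=\begin{pmatrix}e^{i\pi/q}&0\\\rho&e^{-i\pi/q}\end{pmatrix}$, and let $\overline{\mathcal R}_{p,q}$ be the set of all $\rho\in\mathbb C$ such that $\langle A,B_\rho\rangle\subset\mathrm{PSL}(2,\mathbb C)$ is discrete and equal to $\langle A\rangle*\langle B_\rho\rangle$. The four points $$2+2\cos\Big(\frac{\pi}{p}-\frac{\pi}{q}\Big),\quad -2-2\cos\Big(\frac{\pi}{p}+\frac{\pi}{q}\Big),\quad 2\sin\frac{\pi}{p}\sin\frac{\pi}{q}\pm2i\sqrt{1-\sin^2\frac{\pi}{p}\sin^2\frac{\pi}{q}}$$ are distinct, lie on the boundary of $\Omega_{p,q}$, and each of them gives a cusp group: it belongs to $\overline{\mathcal R}_{p,q}$ and to the boundary of $\overline{\mathcal R}_{p,q}$, and $\langle A,B_\rho\rangle$ contains a parabolic element. -/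

import Mathlib

open scoped MatrixGroups ComplexConjugate

noncomputable section

/-- The image in `PSL(2, ℂ)` of an element of `SL(2, ℂ)`. -/
def toPSL (X : SL(2, ℂ)) : PSL(2, ℂ) := QuotientGroup.mk X

/-- The subgroup `⟨X, Y⟩` of `PSL(2, ℂ)` generated by (the classes of) `X` and `Y`. -/
def generatedGroup (X Y : SL(2, ℂ)) : Subgroup PSL(2, ℂ) :=
  Subgroup.closure {toPSL X, toPSL Y}

/-- `X` is a primitive elliptic of order `p` (for `p ≥ 2`): its trace is `2 cos (π / p)`, up to the
sign that is lost in `PSL(2, ℂ)`. For `p ≥ 2` this says that the Möbius transformation of `X` is a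
rotation through the angle `2π / p`; in particular it is elliptic of order exactly `p`
in `PSL(2, ℂ)`. -/
def IsPrimitiveElliptic (p : ℕ) (X : SL(2, ℂ)) : Prop :=
  X.val.trace = ((2 * Real.cos (Real.pi / p) : ℝ) : ℂ) ∨
    X.val.trace = ((-(2 * Real.cos (Real.pi / p)) : ℝ) : ℂ)

/-- The group `⟨X, Y⟩` is a discrete subgroup of `PSL(2, ℂ)`. -/
def IsDiscreteGroup (X Y : SL(2, ℂ)) : Prop :=
  DiscreteTopology (generatedGroup X Y)

/-- The group `⟨X, Y⟩ ⊆ PSL(2, ℂ)` is the free product of its cyclic subgroups `⟨X⟩` and `⟨Y⟩`: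
the homomorphism `⟨X⟩ * ⟨Y⟩ → ⟨X, Y⟩` which restricts to the inclusions is an isomorphism. -/
def IsFreeProduct (X Y : SL(2, ℂ)) : Prop :=
  ∃ φ : Monoid.Coprod (Subgroup.zpowers (toPSL X)) (Subgroup.zpowers (toPSL Y)) ≃*
      generatedGroup X Y,
    (∀ g, (φ (Monoid.Coprod.inl g) : PSL(2, ℂ)) = g) ∧
    (∀ g, (φ (Monoid.Coprod.inr g) : PSL(2, ℂ)) = g)

/-! ### The polygon -/

/-- The abscissa `2 sin (π / p) sin (π / q)` of the axis of symmetry. -/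
def axis (p q : ℕ) : ℝ := 2 * Real.sin (Real.pi / p) * Real.sin (Real.pi / q)

/-- `ξ = √2 √(7 - cos (2π / p))`. -/
def xi (p : ℕ) : ℝ := √2 * √(7 - Real.cos (2 * Real.pi / p))

/-- The constant `ρ*_{p,q}`. -/
def rhoStar (p q : ℕ) : ℂ where
  re := Real.cos (Real.pi / p) * Real.cos (Real.pi / q) +
    1 / 2 * Real.sin (Real.pi / q) * (4 * Real.sin (Real.pi / p) + xi p)
  im := xi p / 2 * Real.cos (Real.pi / q) + Real.cos (Real.pi / p) * Real.sin (Real.pi / q)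

/-- The constant `x_{p,q}`. -/
def xConst (p q : ℕ) : ℝ :=
  (Real.cos (2 * Real.pi / p - 2 * Real.pi / q) - Real.cos (2 * Real.pi / p) -
      Real.cos (2 * Real.pi / q) +
      xi p * (Real.sin (Real.pi / p) - Real.sin (Real.pi / p - 2 * Real.pi / q)) + 5) /
    (Real.cos (Real.pi / p) * Real.cos (Real.pi / q) +
      1 / 2 * Real.sin (Real.pi / q) * (4 * Real.sin (Real.pi / p) + xi p))

/-- Reflection of `ℂ` in the line `Re z = 2 sin (π / p) sin (π / q)`. -/
def reflection (p q : ℕ) (z : ℂ) : ℂ := ((2 * axis p q : ℝ) : ℂ) - conj z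

/-- The twelve lines, each given by a pair of distinct points on it. -/
def boundaryLines (p q : ℕ) : Set (ℂ × ℂ) :=
  let r := reflection p q
  let c : ℂ := ((2 + 2 * Real.cos (Real.pi / p - Real.pi / q) : ℝ) : ℂ)
  let h : ℂ := ((2 * √(1 - Real.sin (Real.pi / p) ^ 2 * Real.sin (Real.pi / q) ^ 2) : ℝ) : ℂ) *
    Complex.I
  let s := rhoStar p q
  let x : ℂ := (xConst p q : ℂ)
  let s' := rhoStar q p
  let x' : ℂ := (xConst q p : ℂ)
  { -- the vertical line through `c`, and its symmetry
    (c, c + Complex.I), (r c, r (c + Complex.I)),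
    -- the horizontal lines through `h` and `-h`
    (h, h + 1), (-h, -h + 1),
    -- the line through `ρ*_{p,q}` and `x_{p,q}`, its complex conjugate, and their symmetries
    (s, x), (conj s, conj x), (r s, r x), (r (conj s), r (conj x)),
    -- the line through `ρ*_{q,p}` and `x_{q,p}`, its complex conjugate, and their symmetries
    (s', x'), (conj s', conj x'), (r s', r x'), (r (conj s'), r (conj x')) }

/-- The signed area function of the line through `a` and `b`: its zero set is that line, and its
sign tells on which side of the line the point `z` lies. -/
def lineSide (a b z : ℂ) : ℝ := ((z - a) * conj (b - a)).im

/-- The open polygon bounded by the twelve lines: the points that lie, for each of the twelve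
lines, strictly on the same side of it as the centre of symmetry `2 sin (π / p) sin (π / q)`. -/
def Omega (p q : ℕ) : Set ℂ :=
  {z | ∀ l ∈ boundaryLines p q, 0 < lineSide l.1 l.2 z * lineSide l.1 l.2 (axis p q : ℂ)}

/-! ### Cusp groups -/

/-- The matrix with rows `(α, 1)` and `(0, α⁻¹)`, where `α = exp (i π / p)`. -/
def matA (p : ℕ) : SL(2, ℂ) :=
  ⟨!![Complex.exp (Complex.I * Real.pi / p), 1; 0, (Complex.exp (Complex.I * Real.pi / p))⁻¹], by
    simp [Matrix.det_fin_two]⟩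

/-- The matrix with rows `(β, 0)` and `(ρ, β⁻¹)`, where `β = exp (i π / q)`. -/
def matB (q : ℕ) (ρ : ℂ) : SL(2, ℂ) :=
  ⟨!![Complex.exp (Complex.I * Real.pi / q), 0; ρ, (Complex.exp (Complex.I * Real.pi / q))⁻¹], by
    simp [Matrix.det_fin_two]⟩

/-- The set of those parameters `ρ` for which the group `⟨A, B_ρ⟩` is discrete and freely generated
by `A` and `B_ρ`, that is, the free product of `⟨A⟩` and `⟨B_ρ⟩`. It is the closure of the
deformation space of `ℤ_p * ℤ_q` in the `ρ`-plane. -/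
def closedDeformationSpace (p q : ℕ) : Set ℂ :=
  {ρ | IsDiscreteGroup (matA p) (matB q ρ) ∧ IsFreeProduct (matA p) (matB q ρ)}

/-- `⟨A, B_ρ⟩` is a cusp group: it is discrete and freely generated by `A` and `B_ρ`, it lies on
the boundary of the deformation space, and it contains a parabolic element. (As `A` and `B_ρ` are
elliptic of finite order, the parabolic element is not conjugate into `⟨A⟩` or `⟨B_ρ⟩`.) -/
def IsCuspGroup (p q : ℕ) (ρ : ℂ) : Prop :=
  ρ ∈ closedDeformationSpace p q ∧
  ρ ∈ frontier (closedDeformationSpace p q) ∧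
  ∃ g : SL(2, ℂ), toPSL g ∈ generatedGroup (matA p) (matB q ρ) ∧ g.val.IsParabolic

/-- The parameters of the four cusp groups of slopes `0`, `1` and `± 1 / 2`. -/
def cuspPoints (p q : ℕ) : Set ℂ :=
  let h : ℝ := 2 * √(1 - Real.sin (Real.pi / p) ^ 2 * Real.sin (Real.pi / q) ^ 2)
  { ((2 + 2 * Real.cos (Real.pi / p - Real.pi / q) : ℝ) : ℂ),
    ((-2 - 2 * Real.cos (Real.pi / p + Real.pi / q) : ℝ) : ℂ),
    ⟨axis p q, h⟩, ⟨axis p q, -h⟩ }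

end

noncomputable section

/-! ### The projection to `PSL(2, ℂ)` -/

/-! Write m for `axis p q`. In the coordinate z = v₀/v₁ the matrix `matA p` rotates the plane
through 2π/p about `fixedPointA`. In the coordinate 1/z the matrix `matB q ρ` rotates it through
−2π/q about `fixedPointB`. Ping-pong is played with two discs whose boundaries pass through 0. In
1/z they are half-planes, and they are chosen so that their common exterior is a sector of angle
2π/q. If `fixedPointB` lies on the correct side, nontrivial powers of B map the exterior into the
discs (`pinwheel`); the centre of rotation need not be the vertex of the sector. If also the
nontrivial A-rotates of the discs avoid the discs, ping-pong works
(`pingPong_of_disjoint_rotations`), and only the rotations through ±2π/p need checking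
(`le_norm_rotate_sub`).

The discs do not involve ρ, which enters only through the position of `fixedPointB`, as an
inequality Re(ρ d̄) ≥ t₁ + t₂. Hence each admissible pair of discs settles a whole half-plane of
parameters (`pingPong_of_halfPlane`), and the sides of the polygon come from such half-planes. Equal
radii give the vertical line and the slanted lines: the foot of the perpendicular from 0 must avoid
four circles of radius 2 (`pingPong_of_foot`), and ρ* is an intersection point of two of them.
Unequal radii give the horizontal line (`pingPong_of_le_im`). The remaining sides follow by complex
conjugation of the foot, by exchanging the generators, and by replacing Y with Y⁻¹, which turns ρ
into 2m − ρ.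

For general X and Y, the traces of X, Y and XY determine the pair up to conjugacy as long as ρ is
neither 0 nor 2m (`exists_conj_matA_matB`), and both of these values lie inside the polygon. The
commutator trace determines tr XY up to the exchange ρ ↔ 2m − ρ, which accounts for (a).

For (b), the four points lie on the boundary of the open polygon, so (a) applies to them. At each,
one of the words AB⁻¹, AB, [A,B] has trace −2 and is parabolic. Nearby there are parameters where
the same word is elliptic of finite order. If the cusp were interior, such a parameter would give a
free product, so its extra relation would follow from those of A and B and would hold at the cusp
too (`IsFreeProduct.lift_eq_one`), although a parabolic has infinite order. -/

theorem toPSL_mul (X Y : SL(2, ℂ)) : toPSL (X * Y) = toPSL X * toPSL Y := rfl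

theorem toPSL_inv (X : SL(2, ℂ)) : toPSL X⁻¹ = (toPSL X)⁻¹ := rfl

theorem toPSL_one : toPSL 1 = 1 := rfl

theorem toPSL_zpow (X : SL(2, ℂ)) (k : ℤ) : toPSL (X ^ k) = toPSL X ^ k := rfl

theorem toPSL_pow (X : SL(2, ℂ)) (k : ℕ) : toPSL (X ^ k) = toPSL X ^ k := rfl

theorem toPSL_eq_one_iff {X : SL(2, ℂ)} : toPSL X = 1 ↔ X = 1 ∨ X = -1 := by
  rw [toPSL, QuotientGroup.eq_one_iff, Matrix.SpecialLinearGroup.mem_center_iff]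
  constructor
  · rintro ⟨r, hr, h⟩
    have hr' : r ^ 2 = 1 := by simpa using hr
    rcases (by simpa using hr' : r = 1 ∨ r = -1) with rfl | rfl
    · left; ext i j; rw [← h]; simp
    · right; ext i j; rw [← h]; fin_cases i <;> fin_cases j <;> simp
  · rintro (rfl | rfl)
    · exact ⟨1, by simp, by simp⟩
    · refine ⟨-1, by simp, ?_⟩
      ext i j; fin_cases i <;> fin_cases j <;> simp

theorem toPSL_eq_iff {X Y : SL(2, ℂ)} : toPSL X = toPSL Y ↔ X = Y ∨ X = -Y := by
  have : toPSL X = toPSL Y ↔ toPSL (X * Y⁻¹) = 1 := by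
    rw [toPSL_mul, toPSL_inv, mul_inv_eq_one]
  rw [this, toPSL_eq_one_iff, mul_inv_eq_one, mul_inv_eq_iff_eq_mul, neg_one_mul]

theorem toPSL_neg (X : SL(2, ℂ)) : toPSL (-X) = toPSL X := toPSL_eq_iff.mpr (Or.inr rfl)

/-! ### Reduced words in a free product of two groups -/

open Monoid.Coprod in
/-- `ReducedWord true w` (resp. `false`) says that `w` is an alternating product of nontrivial
elements of the two factors whose leftmost factor is in `H` (resp. `G`), and whose rightmost factor
is an arbitrary element of `G`. -/
inductive ReducedWord {G H : Type*} [Group G] [Group H] : Bool → Monoid.Coprod G H → Prop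
  | base (h : H) (g : G) : h ≠ 1 → ReducedWord true (inr h * inl g)
  | consInr (h : H) (w : Monoid.Coprod G H) :
      h ≠ 1 → ReducedWord false w → ReducedWord true (inr h * w)
  | consInl (g : G) (w : Monoid.Coprod G H) :
      g ≠ 1 → ReducedWord true w → ReducedWord false (inl g * w)

-- Induction by prepending a syllable: it is merged with the leftmost one if both come from the same
-- factor, and the merged syllable is dropped if trivial. Elements of G need a separate alternative,
-- since a reduced word here contains a syllable from H.
open Monoid.Coprod in
theorem exists_reducedWord {G H : Type*} [Group G] [Group H] (w : Monoid.Coprod G H) :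
    (∃ g, w = inl g) ∨ ∃ i, ReducedWord i w := by
  induction w using Monoid.Coprod.induction_on' with
  | one => exact Or.inl ⟨1, by simp⟩
  | inl_mul g w ih =>
    by_cases hg : g = 1
    · simpa [hg] using ih
    rcases ih with ⟨g', rfl⟩ | ⟨i, h⟩
    · exact Or.inl ⟨g * g', by simp⟩
    cases i with
    | true => exact Or.inr ⟨false, .consInl g w hg h⟩
    | false =>
      cases h with
      | consInl g' w' hg' hw' =>
        by_cases h1 : g * g' = 1
        · refine Or.inr ⟨true, ?_⟩
          rwa [← mul_assoc, ← map_mul, h1, map_one, one_mul]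
        · refine Or.inr ⟨false, ?_⟩
          rw [← mul_assoc, ← map_mul]
          exact .consInl _ _ h1 hw'
  | inr_mul h w ih =>
    by_cases hh : h = 1
    · simpa [hh] using ih
    rcases ih with ⟨g', rfl⟩ | ⟨i, hw⟩
    · exact Or.inr ⟨true, .base h g' hh⟩
    cases i with
    | false => exact Or.inr ⟨true, .consInr h w hh hw⟩
    | true =>
      cases hw with
      | base h' g' hh' =>
        by_cases h1 : h * h' = 1
        · refine Or.inl ⟨g', ?_⟩
          rw [← mul_assoc, ← map_mul, h1, map_one, one_mul]
        · refine Or.inr ⟨true, ?_⟩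
          rw [← mul_assoc, ← map_mul]
          exact .base _ _ h1
      | consInr h' w' hh' hw' =>
        by_cases h1 : h * h' = 1
        · refine Or.inr ⟨false, ?_⟩
          rwa [← mul_assoc, ← map_mul, h1, map_one, one_mul]
        · refine Or.inr ⟨true, ?_⟩
          rw [← mul_assoc, ← map_mul]
          exact .consInr _ _ h1 hw'

/-! ### The ping-pong criterion -/

/-- The natural homomorphism from the free product of `⟨X⟩` and `⟨Y⟩` to `PSL(2, ℂ)`. -/
def freeProductHom (X Y : SL(2, ℂ)) :
    Monoid.Coprod (Subgroup.zpowers (toPSL X)) (Subgroup.zpowers (toPSL Y)) →* PSL(2, ℂ) :=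
  Monoid.Coprod.lift (Subgroup.zpowers (toPSL X)).subtype (Subgroup.zpowers (toPSL Y)).subtype

theorem range_freeProductHom (X Y : SL(2, ℂ)) :
    (freeProductHom X Y).range = generatedGroup X Y := by
  rw [freeProductHom, Monoid.Coprod.range_lift, Subgroup.range_subtype, Subgroup.range_subtype,
    generatedGroup, Subgroup.zpowers_eq_closure, Subgroup.zpowers_eq_closure,
    ← Subgroup.closure_union]
  rfl

theorem isFreeProduct_of_injective {X Y : SL(2, ℂ)}
    (h : Function.Injective (freeProductHom X Y)) : IsFreeProduct X Y := by
  refine ⟨(MonoidHom.ofInjective h).trans (MulEquiv.subgroupCongr (range_freeProductHom X Y)),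
    fun g => ?_, fun g => ?_⟩
  · change freeProductHom X Y (Monoid.Coprod.inl g) = g
    simp [freeProductHom]
  · change freeProductHom X Y (Monoid.Coprod.inr g) = g
    simp [freeProductHom]

/-- Data for a ping-pong argument for `X` and `Y`, phrased in terms of sets of vectors of `ℂ²`:
the powers of `X` map `T` into `S` and preserve `E`, the powers of `Y` map `S ∪ E` into `T`, and
matrices close to the identity do not map the base vector `e` into `S ∪ T`. -/
def PingPong (X Y : SL(2, ℂ)) : Prop :=
  ∃ (e : Fin 2 → ℂ) (S T E : Set (Fin 2 → ℂ)) (O : Set SL(2, ℂ)),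
    (∀ v ∈ S, -v ∈ S) ∧ (∀ v ∈ T, -v ∈ T) ∧
    (∀ k : ℤ, (X ^ k).val.mulVec e ∈ E) ∧
    (∀ k : ℤ, toPSL (X ^ k) ≠ 1 → ∀ v ∈ T, (X ^ k).val.mulVec v ∈ S) ∧
    (∀ k : ℤ, toPSL (Y ^ k) ≠ 1 → ∀ v ∈ S ∪ E, (Y ^ k).val.mulVec v ∈ T) ∧
    IsOpen O ∧ 1 ∈ O ∧ (∀ M ∈ O, M.val.mulVec e ∉ S ∪ T) ∧
    ∀ M ∈ O, ∀ k : ℤ, toPSL M = toPSL (X ^ k) → toPSL M = 1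

/-- The discs are constructed only for `matA` and `matB`; this carries the data over to any
conjugate pair. -/
theorem PingPong.conj {X Y : SL(2, ℂ)} (h : PingPong X Y) (P : SL(2, ℂ)) :
    PingPong (P * X * P⁻¹) (P * Y * P⁻¹) := by
  obtain ⟨e, S, T, E, O, hS, hT, hE, h1, h2, hO, hO1, hOe, hOX⟩ := h
  have key : ∀ (Z : SL(2, ℂ)) (k : ℤ) (v : Fin 2 → ℂ),
      P⁻¹.val.mulVec (((P * Z * P⁻¹) ^ k).val.mulVec v) =
        (Z ^ k).val.mulVec (P⁻¹.val.mulVec v) := by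
    intro Z k v
    have : P⁻¹ * (P * Z * P⁻¹) ^ k = Z ^ k * P⁻¹ := by rw [conj_zpow]; group
    rw [Matrix.mulVec_mulVec, Matrix.mulVec_mulVec, ← Matrix.SpecialLinearGroup.coe_mul,
      ← Matrix.SpecialLinearGroup.coe_mul, this]
  have psl : ∀ (Z : SL(2, ℂ)) (k : ℤ), toPSL ((P * Z * P⁻¹) ^ k) = 1 ↔ toPSL (Z ^ k) = 1 := by
    intro Z k
    rw [conj_zpow, toPSL_mul, toPSL_mul, toPSL_inv, conj_eq_one_iff]
  have hPe : P⁻¹.val.mulVec (P.val.mulVec e) = e := by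
    rw [Matrix.mulVec_mulVec, ← Matrix.SpecialLinearGroup.coe_mul]; simp
  refine ⟨P.val.mulVec e, {v | P⁻¹.val.mulVec v ∈ S}, {v | P⁻¹.val.mulVec v ∈ T},
    {v | P⁻¹.val.mulVec v ∈ E}, {M | P⁻¹ * M * P ∈ O}, ?_, ?_, ?_, ?_, ?_, ?_, ?_, ?_, ?_⟩
  · intro v hv
    change P⁻¹.val.mulVec (-v) ∈ S
    rw [Matrix.mulVec_neg]
    exact hS _ hv
  · intro v hv
    change P⁻¹.val.mulVec (-v) ∈ T
    rw [Matrix.mulVec_neg]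
    exact hT _ hv
  · intro k
    change P⁻¹.val.mulVec _ ∈ E
    rw [key, hPe]; exact hE k
  · intro k hk v hv
    change P⁻¹.val.mulVec _ ∈ S
    rw [key]; exact h1 k (by rwa [Ne, psl] at hk) _ hv
  · intro k hk v hv
    change P⁻¹.val.mulVec _ ∈ T
    rw [key]; exact h2 k (by rwa [Ne, psl] at hk) _ hv
  · exact hO.preimage (by fun_prop)
  · simpa using hO1
  · intro M hM
    have := hOe _ hM
    rwa [Matrix.SpecialLinearGroup.coe_mul, Matrix.SpecialLinearGroup.coe_mul,
      ← Matrix.mulVec_mulVec, ← Matrix.mulVec_mulVec] at this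
  · intro M hM k hk
    have := hOX _ hM k (by
      rw [toPSL_mul, toPSL_mul, hk, conj_zpow, ← toPSL_mul, ← toPSL_mul]; congr 1; group)
    rw [toPSL_mul, toPSL_mul, toPSL_inv] at this
    simpa using (conj_eq_one_iff (a := (toPSL P)⁻¹)).mp (by simpa using this)

/-- The rightmost power of X keeps e in E, the next power of Y sends it into T, and from then on the
image alternates between S and T. -/
theorem PingPong.exists_lift {X Y : SL(2, ℂ)} {e : Fin 2 → ℂ} {S T E : Set (Fin 2 → ℂ)}
    (hE : ∀ k : ℤ, (X ^ k).val.mulVec e ∈ E)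
    (h1 : ∀ k : ℤ, toPSL (X ^ k) ≠ 1 → ∀ v ∈ T, (X ^ k).val.mulVec v ∈ S)
    (h2 : ∀ k : ℤ, toPSL (Y ^ k) ≠ 1 → ∀ v ∈ S ∪ E, (Y ^ k).val.mulVec v ∈ T)
    {i : Bool} {w : Monoid.Coprod (Subgroup.zpowers (toPSL X)) (Subgroup.zpowers (toPSL Y))}
    (hw : ReducedWord i w) :
    ∃ M : SL(2, ℂ), toPSL M = freeProductHom X Y w ∧ M.val.mulVec e ∈ bif i then T else S := by
  have lift : ∀ (Z : SL(2, ℂ)) (g : Subgroup.zpowers (toPSL Z)), ∃ k : ℤ, toPSL (Z ^ k) = g := by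
    rintro Z ⟨g, k, rfl⟩
    exact ⟨k, rfl⟩
  induction hw with
  | base h g hh =>
    obtain ⟨k, hk⟩ := lift Y h
    obtain ⟨l, hl⟩ := lift X g
    refine ⟨Y ^ k * X ^ l, by simp [toPSL_mul, hk, hl, freeProductHom], ?_⟩
    rw [Matrix.SpecialLinearGroup.coe_mul, ← Matrix.mulVec_mulVec]
    exact h2 k (by rw [hk]; simpa using hh) _ (Or.inr (hE l))
  | consInr h w hh _ ih =>
    obtain ⟨k, hk⟩ := lift Y h
    obtain ⟨M, hM, hMe⟩ := ih
    refine ⟨Y ^ k * M, by rw [toPSL_mul, hM, map_mul, hk]; simp [freeProductHom], ?_⟩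
    rw [Matrix.SpecialLinearGroup.coe_mul, ← Matrix.mulVec_mulVec]
    exact h2 k (by rw [hk]; simpa using hh) _ (Or.inl hMe)
  | consInl g w hg _ ih =>
    obtain ⟨k, hk⟩ := lift X g
    obtain ⟨M, hM, hMe⟩ := ih
    refine ⟨X ^ k * M, by rw [toPSL_mul, hM, map_mul, hk]; simp [freeProductHom], ?_⟩
    rw [Matrix.SpecialLinearGroup.coe_mul, ← Matrix.mulVec_mulVec]
    exact h1 k (by rw [hk]; simpa using hg) _ hMe

/-- A group element with a representative in O cannot be a reduced word, because that would move e
into S ∪ T. So it is a power of X, which O forces to be trivial. This gives discreteness, as `toPSL`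
is open, and with M = 1 it gives injectivity. -/
theorem PingPong.isDiscreteGroup_and_isFreeProduct {X Y : SL(2, ℂ)} (h : PingPong X Y) :
    IsDiscreteGroup X Y ∧ IsFreeProduct X Y := by
  obtain ⟨e, S, T, E, O, hS, hT, hE, h1, h2, hO, hO1, hOe, hOX⟩ := h
  have key : ∀ M ∈ O, ∀ w, toPSL M = freeProductHom X Y w → (∃ g, w = Monoid.Coprod.inl g) := by
    intro M hM w hw
    rcases exists_reducedWord w with hg | ⟨i, hi⟩
    · exact hg
    exfalso
    obtain ⟨N, hN, hNe⟩ := PingPong.exists_lift hE h1 h2 hi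
    have hN' : N.val.mulVec e ∈ S ∪ T := by
      cases i
      · exact Or.inl hNe
      · exact Or.inr hNe
    -- The lift of a word is known only up to sign, which is why S and T are required to be
    -- symmetric.
    rcases toPSL_eq_iff.mp (hw.trans hN.symm) with rfl | rfl
    · exact hOe _ hM hN'
    · refine hOe _ hM ?_
      rw [Matrix.SpecialLinearGroup.coe_neg, Matrix.neg_mulVec]
      exact hN'.imp (hS _) (hT _)
  constructor
  · apply discreteTopology_of_isOpen_singleton_one
    rw [isOpen_induced_iff]
    refine ⟨toPSL '' O, QuotientGroup.isOpenMap_coe _ hO, ?_⟩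
    ext ⟨g, hg⟩
    simp only [Set.mem_preimage, Set.mem_image, Set.mem_singleton_iff]
    constructor
    · rintro ⟨M, hM, rfl⟩
      rw [← range_freeProductHom] at hg
      obtain ⟨w, hw⟩ := hg
      obtain ⟨⟨_, k, rfl⟩, rfl⟩ := key M hM w hw.symm
      have := hOX M hM k (by rw [← hw]; simp [freeProductHom, toPSL_zpow])
      simpa [Subtype.ext_iff] using this
    · intro h
      exact ⟨1, hO1, by simpa [Subtype.ext_iff, toPSL_one] using (congrArg Subtype.val h).symm⟩
  · apply isFreeProduct_of_injective
    rw [injective_iff_map_eq_one]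
    intro w hw
    obtain ⟨g, rfl⟩ := key 1 hO1 w (by rw [hw, toPSL_one])
    have : g = 1 := by simpa [freeProductHom] using hw
    rw [this, map_one]

theorem isDiscreteGroup_and_isFreeProduct_comm {X Y : SL(2, ℂ)}
    (h : IsDiscreteGroup X Y ∧ IsFreeProduct X Y) : IsDiscreteGroup Y X ∧ IsFreeProduct Y X := by
  have hg : generatedGroup X Y = generatedGroup Y X := by
    rw [generatedGroup, generatedGroup, Set.pair_comm]
  obtain ⟨h1, φ, h2, h3⟩ := h
  refine ⟨?_, ((MulEquiv.coprodComm _ _).trans φ).trans (MulEquiv.subgroupCongr hg), ?_, ?_⟩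
  · unfold IsDiscreteGroup at h1 ⊢
    rwa [← hg]
  · intro g; simpa using h3 g
  · intro g; simpa using h2 g

theorem isDiscreteGroup_and_isFreeProduct_congr {X Y X' Y' : SL(2, ℂ)}
    (hX : toPSL X = toPSL X') (hY : toPSL Y = toPSL Y')
    (h : IsDiscreteGroup X Y ∧ IsFreeProduct X Y) :
    IsDiscreteGroup X' Y' ∧ IsFreeProduct X' Y' := by
  unfold IsDiscreteGroup IsFreeProduct generatedGroup at h ⊢
  rwa [← hX, ← hY]

/-! ### Powers of `exp (i π / n)` -/

/-- The complex number `exp (i π / n)`. -/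
def expPi (n : ℕ) : ℂ := Complex.exp (Complex.I * Real.pi / n)

theorem expPi_zpow (n : ℕ) (k : ℤ) :
    expPi n ^ k = Complex.exp ((k * (Real.pi / n) : ℝ) * Complex.I) := by
  rw [expPi, ← Complex.exp_int_mul]; push_cast; congr 1; ring

theorem expPi_eq (n : ℕ) :
    expPi n = Real.cos (Real.pi / n) + Real.sin (Real.pi / n) * Complex.I := by
  rw [Complex.ofReal_cos, Complex.ofReal_sin, ← Complex.exp_mul_I, expPi]
  push_cast; congr 1; ring

theorem expPi_inv_eq (n : ℕ) :
    (expPi n)⁻¹ = Real.cos (Real.pi / n) - Real.sin (Real.pi / n) * Complex.I := by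
  rw [expPi, ← Complex.exp_neg,
    show -(Complex.I * Real.pi / n) = ((-(Real.pi / n) : ℝ) : ℂ) * Complex.I by push_cast; ring,
    Complex.exp_mul_I, ← Complex.ofReal_cos, ← Complex.ofReal_sin]
  simp; ring

theorem norm_expPi (n : ℕ) : ‖expPi n‖ = 1 := by
  have := expPi_zpow n 1
  rw [zpow_one] at this
  rw [this, Complex.norm_exp_ofReal_mul_I]

theorem norm_expPi_zpow (n : ℕ) (k : ℤ) : ‖expPi n ^ k‖ = 1 := by
  rw [norm_zpow, norm_expPi, one_zpow]

theorem expPi_ne_zero (n : ℕ) : expPi n ≠ 0 := Complex.exp_ne_zero _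

theorem conj_expPi_zpow (n : ℕ) (k : ℤ) : conj (expPi n ^ k) = expPi n ^ (-k) := by
  rw [zpow_neg, Complex.inv_eq_conj (norm_expPi_zpow n k)]

theorem expPi_zpow_self {n : ℕ} (hn : n ≠ 0) : expPi n ^ (n : ℤ) = -1 := by
  have : (((n : ℤ) * (Real.pi / n) : ℝ) : ℂ) = Real.pi := by
    have : (n : ℝ) ≠ 0 := by exact_mod_cast hn
    norm_cast; field_simp
  rw [expPi_zpow, this, Complex.exp_pi_mul_I]

theorem expPi_zpow_two_mul_self {n : ℕ} (hn : n ≠ 0) : expPi n ^ (2 * (n : ℤ)) = 1 := by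
  rw [mul_comm, zpow_mul, expPi_zpow_self hn]; norm_num

theorem expPi_zpow_emod {n : ℕ} (hn : n ≠ 0) (k l : ℤ) :
    expPi n ^ (2 * k + l) = expPi n ^ (2 * (k % n) + l) := by
  conv_lhs => rw [← Int.emod_add_mul_ediv k n]
  rw [show 2 * (k % n + n * (k / n)) + l = 2 * (n : ℤ) * (k / n) + (2 * (k % n) + l) by ring,
    zpow_add₀ (expPi_ne_zero n), zpow_mul, expPi_zpow_two_mul_self hn, one_zpow, one_mul]

theorem expPi_zpow_neg_two_mul_emod {n : ℕ} (hn : n ≠ 0) (k : ℤ) :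
    expPi n ^ (-(2 * k)) = expPi n ^ (-(2 * (k % n))) := by
  have := expPi_zpow_emod hn k 0
  simp only [add_zero] at this
  rw [zpow_neg, zpow_neg, this]

theorem re_expPi_zpow_mul (n : ℕ) (k : ℤ) (r ψ : ℝ) :
    (expPi n ^ k * (r * Complex.exp (ψ * Complex.I))).re = r * Real.cos (ψ + k * (Real.pi / n)) := by
  rw [expPi_zpow, mul_left_comm, ← Complex.exp_add, ← add_mul, ← Complex.ofReal_add,
    Complex.re_ofReal_mul, Complex.exp_ofReal_mul_I_re, add_comm]

theorem exists_pos_lt_emod {n : ℕ} (hn : n ≠ 0) {k : ℤ} (hk : ¬ (n : ℤ) ∣ k) :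
    ∃ j : ℕ, 0 < j ∧ j < n ∧ k % n = j := by
  have h1 := Int.emod_nonneg k (by exact_mod_cast hn : (n : ℤ) ≠ 0)
  have h2 := Int.emod_lt_of_pos k (by positivity : (0 : ℤ) < n)
  have h3 : k % n ≠ 0 := fun h => hk (Int.dvd_of_emod_eq_zero h)
  exact ⟨(k % n).toNat, by omega, by omega, by omega⟩

/-- Up to sign the power is exp(ijπ/n) with 0 < j < n. This gap bounds nontrivial powers of the
generators away from ±1, which yields both their exact orders and the discreteness of ⟨A⟩. -/
theorem sin_pi_div_le_abs_sin {n : ℕ} (hn : n ≠ 0) {k : ℤ} (hk : ¬ (n : ℤ) ∣ k) :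
    Real.sin (Real.pi / n) ≤ |(expPi n ^ k).im| := by
  obtain ⟨j, hj0, hjn, hj⟩ := exists_pos_lt_emod hn hk
  have hab : |(expPi n ^ k).im| = |(expPi n ^ (j : ℤ)).im| := by
    conv_lhs => rw [← Int.emod_add_mul_ediv k n]
    rw [zpow_add₀ (expPi_ne_zero n), zpow_mul, expPi_zpow_self hn, hj]
    rcases Int.even_or_odd (k / n) with h | h
    · rw [h.neg_one_zpow, mul_one]
    · rw [h.neg_one_zpow, mul_neg_one, Complex.neg_im, abs_neg]
  rw [hab, expPi_zpow, Complex.exp_ofReal_mul_I_im]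
  refine le_trans ?_ (le_abs_self _)
  have hn0 : (0 : ℝ) < n := by positivity
  have hj1 : (1 : ℝ) ≤ j := by exact_mod_cast hj0
  have hjn' : (j : ℝ) + 1 ≤ n := by exact_mod_cast hjn
  have ha : 0 < Real.pi / n := by positivity
  have hja : ((j : ℝ) + 1) * (Real.pi / n) ≤ Real.pi := by
    calc _ ≤ (n : ℝ) * (Real.pi / n) := by gcongr
      _ = Real.pi := by field_simp
  have := Real.sin_sub_sin (((j : ℤ) : ℝ) * (Real.pi / n)) (Real.pi / n)
  have h1 : 0 ≤ Real.sin ((((j : ℤ) : ℝ) * (Real.pi / n) - Real.pi / n) / 2) := by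
    apply Real.sin_nonneg_of_nonneg_of_le_pi <;> push_cast <;> nlinarith
  have h2 : 0 ≤ Real.cos ((((j : ℤ) : ℝ) * (Real.pi / n) + Real.pi / n) / 2) := by
    apply Real.cos_nonneg_of_neg_pi_div_two_le_of_le <;> push_cast <;> nlinarith
  nlinarith [mul_nonneg h1 h2]

/-! ### Rotations of sectors and of discs -/

/-- Rotating a sector of angle `2π / n` about a point other than its vertex: the rotated copies of
the sector `{τ > Re y, Re (ζ⁻² y) > τ'}` are disjoint from it, forming a pinwheel. -/
theorem pinwheel {n : ℕ} (hn : 2 ≤ n) {k : ℤ} (hk : ¬ (n : ℤ) ∣ k) {y : ℂ} {τ τ' : ℝ}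
    (hτ : τ ≤ τ') (h0 : y.re < τ) (h1 : τ' < (expPi n ^ (-2 : ℤ) * y).re) :
    τ < (expPi n ^ (-(2 * k)) * y).re ∨ (expPi n ^ (-(2 * k)) * (expPi n ^ (-2 : ℤ) * y)).re < τ' := by
  have hn0 : n ≠ 0 := by omega
  obtain ⟨j, hj0, hjn, hj⟩ := exists_pos_lt_emod hn0 hk
  rw [expPi_zpow_neg_two_mul_emod hn0, hj]
  set b := Real.pi / n with hb
  -- A half-step turn makes the sector symmetric: with x = r exp(iψ), membership reads r cos(ψ + b)
  -- < τ and τ' < r cos(ψ − b).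
  obtain ⟨x, hx⟩ : ∃ x, x = expPi n ^ (-1 : ℤ) * y := ⟨_, rfl⟩
  have hy : y = expPi n ^ (1 : ℤ) * x := by
    rw [hx, ← mul_assoc, ← zpow_add₀ (expPi_ne_zero n)]; simp
  obtain ⟨r, hr0, hr⟩ : ∃ r : ℝ, 0 ≤ r ∧ x = r * Complex.exp (x.arg * Complex.I) :=
    ⟨‖x‖, norm_nonneg x, (Complex.norm_mul_exp_arg_mul_I x).symm⟩
  have hψ1 := Complex.neg_pi_lt_arg x
  have hψ2 := Complex.arg_le_pi x
  rw [hy] at h0 h1 ⊢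
  simp only [← mul_assoc, ← zpow_add₀ (expPi_ne_zero n)] at h0 h1 ⊢
  generalize x.arg = ψ at *
  subst hr
  rw [re_expPi_zpow_mul] at h0 h1 ⊢
  rw [re_expPi_zpow_mul]
  push_cast at h0 h1 ⊢
  rw [← hb] at h0 h1 ⊢
  have hn' : (0 : ℝ) < n := by positivity
  have hb0 : 0 < b := by positivity
  have hnb : n * b = Real.pi := by rw [hb]; field_simp
  have hj1 : (1 : ℝ) ≤ j := by exact_mod_cast hj0
  have hjn' : (j : ℝ) + 1 ≤ n := by exact_mod_cast hjn
  have hjb : (j : ℝ) * b + b ≤ Real.pi := by nlinarith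
  have hb2 : b ≤ j * b := by nlinarith
  have hsb : 0 < Real.sin b := Real.sin_pos_of_pos_of_lt_pi hb0 (by linarith)
  by_contra! hcon
  obtain ⟨h2, h3⟩ := hcon
  have e1 : Real.cos (ψ + -1 * b) - Real.cos (ψ + 1 * b) = 2 * Real.sin ψ * Real.sin b := by
    rw [Real.cos_sub_cos]; ring_nf; rw [Real.sin_neg]; ring
  have e2 : Real.cos (ψ + (-(2 * j) + -1) * b) - Real.cos (ψ + (-(2 * j) + 1) * b) =
      2 * Real.sin (ψ - 2 * (j * b)) * Real.sin b := by
    rw [Real.cos_sub_cos]; ring_nf; rw [Real.sin_neg]; ring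
  have e3 : Real.cos (ψ + (-(2 * j) + 1) * b) - Real.cos (ψ + -1 * b) =
      2 * Real.sin (ψ - j * b) * Real.sin (j * b - b) := by
    rw [Real.cos_sub_cos, show (ψ + (-(2 * j) + 1) * b - (ψ + -1 * b)) / 2 = -(j * b - b) by
      ring, Real.sin_neg]; ring_nf
  have e4 : Real.cos (ψ + 1 * b) - Real.cos (ψ + (-(2 * j) + -1) * b) =
      2 * Real.sin (-(ψ - j * b)) * Real.sin (j * b + b) := by
    rw [Real.cos_sub_cos, Real.sin_neg]; ring_nf
  have hpos : 0 < r * (2 * Real.sin ψ * Real.sin b) := by rw [← e1]; linarith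
  have hr1 : 0 < r := lt_of_le_of_ne hr0 (by rintro rfl; simp at hpos)
  have hsψ : 0 < Real.sin ψ := by
    have := pos_of_mul_pos_right hpos hr0
    exact pos_of_mul_pos_left (by linarith : 0 < Real.sin ψ * Real.sin b) hsb.le
  have hψ0 : 0 < ψ := by
    by_contra! h
    linarith [Real.sin_nonpos_of_nonpos_of_neg_pi_le h hψ1.le]
  have hs2 : 0 ≤ Real.sin (ψ - 2 * (j * b)) := by
    have : 0 ≤ r * (2 * Real.sin (ψ - 2 * (j * b)) * Real.sin b) := by rw [← e2]; linarith
    have := nonneg_of_mul_nonneg_right this hr1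
    exact nonneg_of_mul_nonneg_left (by linarith : 0 ≤ Real.sin (ψ - 2 * (j * b)) * Real.sin b) hsb
  -- Since sin(ψ − 2jb) ≥ 0, the angle ψ − 2jb is nonnegative or at most −π. In the first case `e3`
  -- contradicts `h2`; in the second `e4` contradicts `h3`.
  rcases le_or_gt 0 (ψ - 2 * (j * b)) with h | h
  · have s1 := Real.sin_nonneg_of_nonneg_of_le_pi (x := ψ - j * b) (by linarith) (by linarith)
    have s2 := Real.sin_nonneg_of_nonneg_of_le_pi (x := j * b - b) (by linarith) (by linarith)
    have : 0 ≤ r * (2 * Real.sin (ψ - j * b) * Real.sin (j * b - b)) := by positivity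
    rw [← e3] at this
    linarith
  · have h' : ψ - 2 * (j * b) ≤ -Real.pi := by
      by_contra! h'
      linarith [Real.sin_neg_of_neg_of_neg_pi_lt h h']
    have s1 := Real.sin_nonneg_of_nonneg_of_le_pi (x := -(ψ - j * b)) (by linarith) (by linarith)
    have s2 := Real.sin_nonneg_of_nonneg_of_le_pi (x := j * b + b) (by linarith) (by linarith)
    have : 0 ≤ r * (2 * Real.sin (-(ψ - j * b)) * Real.sin (j * b + b)) := by positivity
    rw [← e4] at this
    linarith

/-- If P ≠ 0 is at least as far right as its two neighbouring rotates, then |arg P| ≤ π/n, and the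
other rotates stay to the left of the neighbours. -/
theorem re_expPi_zpow_mul_le {n : ℕ} (hn : 2 ≤ n) {k : ℤ} (hk : ¬ (n : ℤ) ∣ k) {P : ℂ} {m : ℝ}
    (h0 : m ≤ P.re) (h1 : (expPi n ^ (2 : ℤ) * P).re ≤ m) (h2 : (expPi n ^ (-2 : ℤ) * P).re ≤ m) :
    (expPi n ^ (2 * k) * P).re ≤ m := by
  have hn0 : n ≠ 0 := by omega
  obtain ⟨j, hj0, hjn, hj⟩ := exists_pos_lt_emod hn0 hk
  have := expPi_zpow_emod hn0 k 0
  simp only [add_zero] at this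
  rw [this, hj]
  set a := Real.pi / n with ha
  obtain ⟨r, hr0, hr⟩ : ∃ r : ℝ, 0 ≤ r ∧ P = r * Complex.exp (P.arg * Complex.I) :=
    ⟨‖P‖, norm_nonneg P, (Complex.norm_mul_exp_arg_mul_I P).symm⟩
  have hψ1 := Complex.neg_pi_lt_arg P
  have hψ2 := Complex.arg_le_pi P
  generalize P.arg = ψ at *
  subst hr
  rw [re_expPi_zpow_mul] at h1 h2 ⊢
  rw [Complex.re_ofReal_mul, Complex.exp_ofReal_mul_I_re] at h0
  push_cast at h1 h2 ⊢
  rw [← ha] at h1 h2 ⊢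
  have hn' : (0 : ℝ) < n := by positivity
  have ha0 : 0 < a := by positivity
  have hna : n * a = Real.pi := by rw [ha]; field_simp
  have hj1 : (1 : ℝ) ≤ j := by exact_mod_cast hj0
  have ha2 : a ≤ j * a := by nlinarith
  have hn2 : (2 : ℝ) ≤ n := by exact_mod_cast hn
  have h2a : 2 * a ≤ Real.pi := by nlinarith
  rcases eq_or_lt_of_le hr0 with rfl | hr1
  · simpa using h1
  -- The case j = n − 1 is the rotation through −2π/n, which is `h2`; every smaller j is compared
  -- with j = 1.
  rcases eq_or_lt_of_le (Nat.succ_le_of_lt hjn) with hj' | hj'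
  · have : (j : ℝ) * a = Real.pi - a := by
      rw [← hna, ← hj']; push_cast; ring
    rw [show ψ + 2 * j * a = ψ + -2 * a + 2 * Real.pi by linarith, Real.cos_add_two_pi]
    exact h2
  have hj2 : (j : ℝ) + 2 ≤ n := by exact_mod_cast hj'
  have hja : (j : ℝ) * a + 2 * a ≤ Real.pi := by nlinarith
  have hsa : 0 < Real.sin a := Real.sin_pos_of_pos_of_lt_pi ha0 (by linarith)
  have e1 : Real.cos ψ - Real.cos (ψ + 2 * a) = 2 * Real.sin (ψ + a) * Real.sin a := by
    rw [Real.cos_sub_cos, show (ψ - (ψ + 2 * a)) / 2 = -a by ring, Real.sin_neg]; ring_nf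
  have e2 : Real.cos ψ - Real.cos (ψ + -2 * a) = 2 * Real.sin (a - ψ) * Real.sin a := by
    rw [Real.cos_sub_cos, show (ψ + (ψ + -2 * a)) / 2 = -(a - ψ) by ring, Real.sin_neg]; ring_nf
  have e3 : Real.cos (ψ + 2 * a) - Real.cos (ψ + 2 * j * a) =
      2 * Real.sin (ψ + j * a + a) * Real.sin (j * a - a) := by
    rw [Real.cos_sub_cos, show (ψ + 2 * a - (ψ + 2 * j * a)) / 2 = -(j * a - a) by ring,
      Real.sin_neg]; ring_nf
  have s1 : 0 ≤ Real.sin (ψ + a) := by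
    have : 0 ≤ r * (2 * Real.sin (ψ + a) * Real.sin a) := by rw [← e1]; linarith
    have := nonneg_of_mul_nonneg_right this hr1
    exact nonneg_of_mul_nonneg_left (by linarith : 0 ≤ Real.sin (ψ + a) * Real.sin a) hsa
  have s2 : 0 ≤ Real.sin (a - ψ) := by
    have : 0 ≤ r * (2 * Real.sin (a - ψ) * Real.sin a) := by rw [← e2]; linarith
    have := nonneg_of_mul_nonneg_right this hr1
    exact nonneg_of_mul_nonneg_left (by linarith : 0 ≤ Real.sin (a - ψ) * Real.sin a) hsa
  have b1 : -a ≤ ψ := by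
    by_contra! h
    linarith [Real.sin_neg_of_neg_of_neg_pi_lt (x := ψ + a) (by linarith) (by linarith)]
  have b2 : ψ ≤ a := by
    by_contra! h
    linarith [Real.sin_neg_of_neg_of_neg_pi_lt (x := a - ψ) (by linarith) (by linarith)]
  have s3 := Real.sin_nonneg_of_nonneg_of_le_pi (x := ψ + j * a + a) (by linarith) (by linarith)
  have s4 := Real.sin_nonneg_of_nonneg_of_le_pi (x := j * a - a) (by linarith) (by linarith)
  have : 0 ≤ r * (2 * Real.sin (ψ + j * a + a) * Real.sin (j * a - a)) := by positivity
  rw [← e3] at this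
  linarith

theorem normSq_rotate_sub {c : ℂ} (hc : ‖c‖ = 1) (x x' : ℂ) :
    ‖c * x - x'‖ ^ 2 = ‖x‖ ^ 2 + ‖x'‖ ^ 2 - 2 * (c * (x * conj x')).re := by
  rw [← Complex.normSq_eq_norm_sq, Complex.normSq_sub, Complex.normSq_eq_norm_sq,
    Complex.normSq_eq_norm_sq, norm_mul, hc, one_mul, mul_assoc]

/-- If two discs touch or overlap, and the first and last rotations (through `2π / n`) of the one
are disjoint from the other, then so are the intermediate ones. -/
theorem le_norm_rotate_sub {n : ℕ} (hn : 2 ≤ n) {k : ℤ} (hk : ¬ (n : ℤ) ∣ k) {x x' : ℂ} {r : ℝ}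
    (hr : 0 ≤ r) (h0 : ‖x - x'‖ ≤ r) (h1 : r ≤ ‖expPi n ^ (2 : ℤ) * x - x'‖)
    (h2 : r ≤ ‖expPi n ^ (-2 : ℤ) * x - x'‖) : r ≤ ‖expPi n ^ (2 * k) * x - x'‖ := by
  have g0 := pow_le_pow_left₀ (norm_nonneg _) h0 2
  have g1 := pow_le_pow_left₀ hr h1 2
  have g2 := pow_le_pow_left₀ hr h2 2
  have := normSq_rotate_sub (c := 1) (by simp) x x'
  rw [one_mul, one_mul] at this
  rw [this] at g0
  rw [normSq_rotate_sub (norm_expPi_zpow _ _)] at g1 g2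
  have key := re_expPi_zpow_mul_le hn hk (P := x * conj x')
    (m := (‖x‖ ^ 2 + ‖x'‖ ^ 2 - r ^ 2) / 2) (by linarith) (by linarith) (by linarith)
  refine le_of_sq_le_sq ?_ (norm_nonneg _)
  rw [normSq_rotate_sub (norm_expPi_zpow _ _)]
  linarith

/-! ### The powers of the two generators -/

/-- Used for linear forms that a generator multiplies by a scalar: v₁ and v₀ − `fixedPointA` v₁ for
A, v₀ and v₁ − `fixedPointB` v₀ for B. They describe all powers without computing any matrix power.
-/
theorem semiinvariant_zpow {X : SL(2, ℂ)} {f : (Fin 2 → ℂ) → ℂ} {c : ℂ} (hc : c ≠ 0)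
    (h : ∀ v, f (X.val.mulVec v) = c * f v) (k : ℤ) (v : Fin 2 → ℂ) :
    f ((X ^ k).val.mulVec v) = c ^ k * f v := by
  induction k generalizing v with
  | zero => simp [Matrix.SpecialLinearGroup.coe_one, -Matrix.mulVec_cons]
  | succ k ih =>
    rw [zpow_add_one, Matrix.SpecialLinearGroup.coe_mul, ← Matrix.mulVec_mulVec, ih, h,
      zpow_add_one₀ hc, mul_assoc]
  | pred k ih =>
    have : f v = c * f (X⁻¹.val.mulVec v) := by
      rw [← h, Matrix.mulVec_mulVec, ← Matrix.SpecialLinearGroup.coe_mul, mul_inv_cancel,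
        Matrix.SpecialLinearGroup.coe_one, Matrix.one_mulVec]
    rw [zpow_sub_one, Matrix.SpecialLinearGroup.coe_mul, ← Matrix.mulVec_mulVec, ih, this,
      zpow_sub_one₀ hc]
    field_simp

theorem sin_pi_div_pos {n : ℕ} (hn : 2 ≤ n) : 0 < Real.sin (Real.pi / n) := by
  have h2 : (2 : ℝ) ≤ n := by exact_mod_cast hn
  apply Real.sin_pos_of_pos_of_lt_pi (by positivity)
  rw [div_lt_iff₀ (by positivity)]
  nlinarith [Real.pi_pos]

/-- The finite fixed point of `matA p`. -/
def fixedPointA (p : ℕ) : ℂ := Complex.I / (2 * Real.sin (Real.pi / p))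

/-- The inverse of the nonzero fixed point of `matB q ρ`. -/
def fixedPointB (q : ℕ) (ρ : ℂ) : ℂ := -(Complex.I * ρ) / (2 * Real.sin (Real.pi / q))

theorem fixedPointA_mul {p : ℕ} (hp : 2 ≤ p) : fixedPointA p * ((expPi p)⁻¹ - expPi p) = 1 := by
  have : (Real.sin (Real.pi / p) : ℂ) ≠ 0 := by exact_mod_cast (sin_pi_div_pos hp).ne'
  rw [expPi_inv_eq, expPi_eq, fixedPointA]
  field_simp
  ring_nf
  simp

theorem fixedPointB_mul {q : ℕ} (hq : 2 ≤ q) (ρ : ℂ) :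
    fixedPointB q ρ * (expPi q - (expPi q)⁻¹) = ρ := by
  have : (Real.sin (Real.pi / q) : ℂ) ≠ 0 := by exact_mod_cast (sin_pi_div_pos hq).ne'
  rw [expPi_inv_eq, expPi_eq, fixedPointB]
  field_simp
  ring_nf
  simp

theorem matA_mulVec_zero (p : ℕ) (v : Fin 2 → ℂ) :
    (matA p).val.mulVec v 0 = expPi p * v 0 + v 1 := by
  simp [matA, expPi, Matrix.mulVec, dotProduct, Fin.sum_univ_two]

theorem matA_mulVec_one (p : ℕ) (v : Fin 2 → ℂ) :
    (matA p).val.mulVec v 1 = (expPi p)⁻¹ * v 1 := by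
  simp [matA, expPi, Matrix.mulVec, dotProduct, Fin.sum_univ_two]

theorem matB_mulVec_zero (q : ℕ) (ρ : ℂ) (v : Fin 2 → ℂ) :
    (matB q ρ).val.mulVec v 0 = expPi q * v 0 := by
  simp [matB, expPi, Matrix.mulVec, dotProduct, Fin.sum_univ_two]

theorem matB_mulVec_one (q : ℕ) (ρ : ℂ) (v : Fin 2 → ℂ) :
    (matB q ρ).val.mulVec v 1 = ρ * v 0 + (expPi q)⁻¹ * v 1 := by
  simp [matB, expPi, Matrix.mulVec, dotProduct, Fin.sum_univ_two]

theorem matA_zpow_mulVec_one (p : ℕ) (k : ℤ) (v : Fin 2 → ℂ) :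
    (matA p ^ k).val.mulVec v 1 = expPi p ^ (-k) * v 1 := by
  rw [semiinvariant_zpow (f := fun v => v 1) (inv_ne_zero (expPi_ne_zero p)) (matA_mulVec_one p),
    inv_zpow, zpow_neg]

theorem matA_zpow_mulVec_sub {p : ℕ} (hp : 2 ≤ p) (k : ℤ) (v : Fin 2 → ℂ) :
    (matA p ^ k).val.mulVec v 0 - fixedPointA p * (matA p ^ k).val.mulVec v 1 =
      expPi p ^ k * (v 0 - fixedPointA p * v 1) := by
  refine semiinvariant_zpow (f := fun v => v 0 - fixedPointA p * v 1) (expPi_ne_zero p)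
    (fun v => ?_) k v
  simp only [matA_mulVec_zero, matA_mulVec_one]
  linear_combination (-v 1) * fixedPointA_mul hp

theorem matB_zpow_mulVec_zero (q : ℕ) (ρ : ℂ) (k : ℤ) (v : Fin 2 → ℂ) :
    (matB q ρ ^ k).val.mulVec v 0 = expPi q ^ k * v 0 :=
  semiinvariant_zpow (f := fun v => v 0) (expPi_ne_zero q) (matB_mulVec_zero q ρ) k v

theorem matB_zpow_mulVec_sub {q : ℕ} (hq : 2 ≤ q) (ρ : ℂ) (k : ℤ) (v : Fin 2 → ℂ) :
    (matB q ρ ^ k).val.mulVec v 1 - fixedPointB q ρ * (matB q ρ ^ k).val.mulVec v 0 =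
      expPi q ^ (-k) * (v 1 - fixedPointB q ρ * v 0) := by
  rw [semiinvariant_zpow (f := fun v => v 1 - fixedPointB q ρ * v 0)
    (inv_ne_zero (expPi_ne_zero q)) (fun v => ?_) k v, inv_zpow, zpow_neg]
  simp only [matB_mulVec_zero, matB_mulVec_one]
  linear_combination (-v 0) * fixedPointB_mul hq ρ

theorem eq_neg_one_of_mulVec {X : SL(2, ℂ)} (h : ∀ v, X.val.mulVec v = -v) : X = -1 := by
  apply Subtype.ext
  apply Matrix.ext_of_mulVec_single
  intro i
  rw [h, Matrix.SpecialLinearGroup.coe_neg, Matrix.SpecialLinearGroup.coe_one, Matrix.neg_mulVec,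
    Matrix.one_mulVec]

theorem matA_zpow_self {p : ℕ} (hp : 2 ≤ p) : matA p ^ (p : ℤ) = -1 := by
  have hp0 : p ≠ 0 := by omega
  apply eq_neg_one_of_mulVec
  intro v
  have h1 := matA_zpow_mulVec_one p p v
  have h0 := matA_zpow_mulVec_sub hp p v
  rw [zpow_neg, expPi_zpow_self hp0] at h1
  rw [expPi_zpow_self hp0, h1] at h0
  ext i
  fin_cases i
  · change _ = -v 0
    rw [Fin.zero_eta]
    linear_combination h0
  · change _ = -v 1
    rw [Fin.mk_one, h1]; norm_num

theorem matB_zpow_self {q : ℕ} (hq : 2 ≤ q) (ρ : ℂ) : matB q ρ ^ (q : ℤ) = -1 := by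
  have hq0 : q ≠ 0 := by omega
  apply eq_neg_one_of_mulVec
  intro v
  have h1 := matB_zpow_mulVec_zero q ρ q v
  have h0 := matB_zpow_mulVec_sub hq ρ q v
  rw [expPi_zpow_self hq0] at h1
  rw [zpow_neg, expPi_zpow_self hq0, h1] at h0
  ext i
  fin_cases i
  · change _ = -v 0
    rw [Fin.zero_eta, h1]; ring
  · change _ = -v 1
    rw [Fin.mk_one]
    linear_combination h0

theorem toPSL_matA_zpow {p : ℕ} (hp : 2 ≤ p) (k : ℤ) : toPSL (matA p ^ k) = 1 ↔ (p : ℤ) ∣ k := by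
  constructor
  · intro h
    by_contra hk
    have h1 := sin_pi_div_le_abs_sin (by omega) hk
    have h2 := sin_pi_div_pos hp
    have h3 := matA_zpow_mulVec_sub hp k ![1, 0]
    rw [matA_zpow_mulVec_one] at h3
    have h4 : (expPi p ^ k).im = 0 := by
      rcases toPSL_eq_one_iff.mp h with h | h <;> rw [h] at h3 <;> simp at h3 <;> rw [← h3] <;> simp
    rw [h4, abs_zero] at h1
    linarith
  · rintro ⟨m, rfl⟩
    rw [zpow_mul, toPSL_zpow, toPSL_eq_one_iff.mpr (Or.inr (matA_zpow_self hp)), one_zpow]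

theorem toPSL_matB_zpow {q : ℕ} (hq : 2 ≤ q) (ρ : ℂ) (k : ℤ) :
    toPSL (matB q ρ ^ k) = 1 ↔ (q : ℤ) ∣ k := by
  constructor
  · intro h
    by_contra hk
    have h1 := sin_pi_div_le_abs_sin (by omega) hk
    have h2 := sin_pi_div_pos hq
    have h3 := matB_zpow_mulVec_zero q ρ k ![1, 0]
    have h4 : (expPi q ^ k).im = 0 := by
      rcases toPSL_eq_one_iff.mp h with h | h <;> rw [h] at h3 <;> simp at h3 <;> rw [← h3] <;> simp
    rw [h4, abs_zero] at h1
    linarith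
  · rintro ⟨m, rfl⟩
    rw [zpow_mul, toPSL_zpow, toPSL_eq_one_iff.mpr (Or.inr (matB_zpow_self hq ρ)), one_zpow]

/-! ### Ping-pong with two discs -/

/-- The disc with centre `ū / 2t` and radius `1 / 2t` is the image of a half-plane under
inversion. -/
theorem sq_norm_sub_disc {u : ℂ} (hu : ‖u‖ = 1) {t : ℝ} (ht : 0 < t) (z w : ℂ) :
    ‖z - conj u / (2 * t) * w‖ ^ 2 - (‖w‖ / (2 * t)) ^ 2 =
      (t * ‖z‖ ^ 2 - (conj u * w * conj z).re) / t := by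
  have hu' : u.re * u.re + u.im * u.im = 1 := by
    rw [← Complex.normSq_apply, Complex.normSq_eq_norm_sq, hu, one_pow]
  have e : conj u / (2 * t) * w = ((1 / (2 * t) : ℝ) : ℂ) * (conj u * w) := by
    push_cast; field_simp
  have e2 : ‖conj u * w‖ = ‖w‖ := by rw [norm_mul, Complex.norm_conj, hu, one_mul]
  have e3 : (z * conj (conj u * w)).re = (conj u * w * conj z).re := by
    rw [← Complex.conj_re, map_mul, Complex.conj_conj, mul_comm]
  rw [e, ← Complex.normSq_eq_norm_sq, Complex.normSq_sub, Complex.normSq_eq_norm_sq,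
    Complex.normSq_eq_norm_sq, norm_mul, e2, map_mul, Complex.conj_ofReal, mul_left_comm,
    Complex.re_ofReal_mul, e3, Complex.norm_real, Real.norm_eq_abs, abs_of_pos (by positivity)]
  field_simp
  ring

theorem norm_sub_disc_lt_iff {u : ℂ} (hu : ‖u‖ = 1) {t : ℝ} (ht : 0 < t) (z w : ℂ) :
    ‖z - conj u / (2 * t) * w‖ < ‖w‖ / (2 * t) ↔ t * ‖z‖ ^ 2 < (conj u * w * conj z).re := by
  rw [← sq_lt_sq₀ (norm_nonneg _) (by positivity), ← sub_neg, sq_norm_sub_disc hu ht,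
    div_neg_iff]
  constructor
  · rintro (h | h)
    · linarith
    · linarith
  · intro h
    exact Or.inr ⟨by linarith, ht⟩

theorem lt_norm_sub_disc_iff {u : ℂ} (hu : ‖u‖ = 1) {t : ℝ} (ht : 0 < t) (z w : ℂ) :
    ‖w‖ / (2 * t) < ‖z - conj u / (2 * t) * w‖ ↔ (conj u * w * conj z).re < t * ‖z‖ ^ 2 := by
  rw [← sq_lt_sq₀ (by positivity) (norm_nonneg _), ← sub_pos, sq_norm_sub_disc hu ht,
    div_pos_iff_of_pos_right ht, sub_pos]

/-- T is the union of the two discs, S the union of its nontrivial rotates under A, and E the point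
∞. By `hdisj` the set S lies outside the discs. In the coordinate 1/z, `hu01` makes the exterior a
sector of angle 2π/q and `hsum` places `fixedPointB` as `pinwheel` requires. -/
theorem pingPong_of_disjoint_rotations {p q : ℕ} (hp : 2 ≤ p) (hq : 2 ≤ q) {ρ : ℂ}
    {u : Fin 2 → ℂ} {t : Fin 2 → ℝ} (hu : ∀ i, ‖u i‖ = 1) (ht : ∀ i, 0 < t i)
    (hu01 : u 1 = -(expPi q ^ (2 : ℤ)) * u 0)
    (hsum : t 0 + t 1 ≤ (conj (u 0) * fixedPointB q ρ).re + (conj (u 1) * fixedPointB q ρ).re)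
    (hdisj : ∀ k : ℤ, ¬ (p : ℤ) ∣ k → ∀ i j, 1 / (2 * t i) + 1 / (2 * t j) ≤
      ‖expPi p ^ (2 * k) * (conj (u i) / (2 * t i) - fixedPointA p) -
        (conj (u j) / (2 * t j) - fixedPointA p)‖) :
    PingPong (matA p) (matB q ρ) := by
  set T : Set (Fin 2 → ℂ) :=
    {v | ∃ i, ‖v 0 - conj (u i) / (2 * t i) * v 1‖ < ‖v 1‖ / (2 * t i)} with hT
  set S : Set (Fin 2 → ℂ) :=
    {v | ∃ k : ℤ, ¬ (p : ℤ) ∣ k ∧ ∃ v' ∈ T, v = (matA p ^ k).val.mulVec v'} with hS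
  set E : Set (Fin 2 → ℂ) := {v | v 0 ≠ 0 ∧ v 1 = 0} with hE
  -- The i-th disc lies in |z| < 1/tᵢ, and rotating about `fixedPointA` increases |z| by at most
  -- twice the modulus of that point. So S ∪ T lies in the cone ‖v₀‖ < C‖v₁‖, which avoids ∞.
  set C : ℝ := 2 * ‖fixedPointA p‖ + 1 / t 0 + 1 / t 1 with hC
  have ht0 := ht 0
  have ht1 := ht 1
  have hTneg : ∀ v ∈ T, -v ∈ T := by
    rintro v ⟨i, hi⟩
    refine ⟨i, ?_⟩
    rwa [Pi.neg_apply, Pi.neg_apply, norm_neg, mul_neg, ← neg_sub', norm_neg]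
  have hTC : ∀ v ∈ T, ‖v 0‖ < (1 / t 0 + 1 / t 1) * ‖v 1‖ := by
    rintro v ⟨i, hi⟩
    have h1 : ‖v 0‖ ≤ ‖v 0 - conj (u i) / (2 * t i) * v 1‖ + ‖conj (u i) / (2 * t i) * v 1‖ := by
      simpa using norm_add_le (v 0 - conj (u i) / (2 * t i) * v 1) (conj (u i) / (2 * t i) * v 1)
    have h2 : ‖conj (u i) / (2 * t i) * v 1‖ = ‖v 1‖ / (2 * t i) := by
      rw [norm_mul, norm_div, Complex.norm_conj, hu, norm_mul, Complex.norm_real,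
        Real.norm_eq_abs, abs_of_pos (ht i)]
      simp; ring
    have h3 : ‖v 1‖ / (2 * t i) + ‖v 1‖ / (2 * t i) = 1 / t i * ‖v 1‖ := by
      have := ht i
      field_simp; ring
    have h4 : 1 / t i ≤ 1 / t 0 + 1 / t 1 := by
      have := one_div_pos.mpr ht0
      have := one_div_pos.mpr ht1
      fin_cases i
      · simp only [Fin.zero_eta]; linarith
      · simp only [Fin.mk_one]; linarith
    have h5 := mul_le_mul_of_nonneg_right h4 (norm_nonneg (v 1))
    linarith
  have hSC : ∀ v ∈ S, ‖v 0‖ < C * ‖v 1‖ := by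
    rintro v ⟨k, hk, v', hv', rfl⟩
    have h1 := hTC v' hv'
    have e1 : ‖(matA p ^ k).val.mulVec v' 1‖ = ‖v' 1‖ := by
      rw [matA_zpow_mulVec_one, norm_mul, norm_expPi_zpow, one_mul]
    have e0 := congrArg norm (matA_zpow_mulVec_sub hp k v')
    rw [norm_mul, norm_expPi_zpow, one_mul] at e0
    have h2 := norm_sub_norm_le ((matA p ^ k).val.mulVec v' 0)
      (fixedPointA p * (matA p ^ k).val.mulVec v' 1)
    have h3 := norm_sub_le (v' 0) (fixedPointA p * v' 1)
    rw [norm_mul] at h2 h3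
    rw [e1] at h2 ⊢
    rw [hC]
    linarith
  have hout : ∀ v ∈ S ∪ E, ∀ j, (conj (u j) * v 1 * conj (v 0)).re < t j * ‖v 0‖ ^ 2 := by
    rintro v (⟨k, hk, v', ⟨i, hi⟩, rfl⟩ | ⟨h0, h1⟩) j
    · rw [← lt_norm_sub_disc_iff (hu j) (ht j)]
      have e1 := matA_zpow_mulVec_one p k v'
      have e0 := matA_zpow_mulVec_sub hp k v'
      set w := (matA p ^ k).val.mulVec v'
      have n1 : ‖w 1‖ = ‖v' 1‖ := by rw [e1, norm_mul, norm_expPi_zpow, one_mul]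
      -- The difference of the rotated centre and the j-th centre, plus a vector shorter than the
      -- i-th radius (all scaled by ‖v' 1‖): the triangle inequality and `hdisj` leave w outside the
      -- j-th disc.
      have key : w 0 - conj (u j) / (2 * t j) * w 1 =
          expPi p ^ (-k) * ((expPi p ^ (2 * k) * (conj (u i) / (2 * t i) - fixedPointA p) -
            (conj (u j) / (2 * t j) - fixedPointA p)) * v' 1) +
          expPi p ^ k * (v' 0 - conj (u i) / (2 * t i) * v' 1) := by
        have hk2 : expPi p ^ k = expPi p ^ (-k) * expPi p ^ (2 * k) := by
          rw [← zpow_add₀ (expPi_ne_zero p)]; congr 1; ring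
        rw [e1] at e0 ⊢
        linear_combination e0 + (conj (u i) / (2 * t i) - fixedPointA p) * v' 1 * hk2
      have h2 := norm_sub_le_norm_add (expPi p ^ (-k) *
        ((expPi p ^ (2 * k) * (conj (u i) / (2 * t i) - fixedPointA p) -
            (conj (u j) / (2 * t j) - fixedPointA p)) * v' 1))
        (expPi p ^ k * (v' 0 - conj (u i) / (2 * t i) * v' 1))
      rw [← key, norm_mul, norm_mul (expPi p ^ k), norm_expPi_zpow, norm_expPi_zpow, one_mul,
        one_mul, norm_mul] at h2
      have h3 := mul_le_mul_of_nonneg_right (hdisj k hk i j) (norm_nonneg (v' 1))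
      rw [n1]
      have h4 : (1 / (2 * t i) + 1 / (2 * t j)) * ‖v' 1‖ =
        ‖v' 1‖ / (2 * t i) + ‖v' 1‖ / (2 * t j) := by ring
      linarith
    · have := ht j
      rw [h1]
      simp only [mul_zero, zero_mul, Complex.zero_re]
      positivity
  -- The first condition on M excludes nontrivial powers of A; the second keeps the image of the
  -- base vector out of the cone containing S ∪ T.
  refine ⟨![1, 0], S, T, E, {M | |(M.val 0 0).im| < Real.sin (Real.pi / p) ∧
    C * ‖M.val 1 0‖ < ‖M.val 0 0‖}, ?_, hTneg, ?_, ?_, ?_, ?_, ?_, ?_, ?_⟩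
  · rintro v ⟨k, hk, v', hv', rfl⟩
    exact ⟨k, hk, -v', hTneg _ hv', by rw [Matrix.mulVec_neg]⟩
  · intro k
    have h1 := matA_zpow_mulVec_one p k ![1, 0]
    have h0 := matA_zpow_mulVec_sub hp k ![1, 0]
    set w := (matA p ^ k).val.mulVec ![1, 0]
    have hw1 : w 1 = 0 := by rw [h1]; simp
    refine ⟨?_, hw1⟩
    rw [hw1] at h0
    have : w 0 = expPi p ^ k := by simpa using h0
    rw [this]
    exact zpow_ne_zero _ (expPi_ne_zero p)
  · intro k hk v hv
    exact ⟨k, by rwa [Ne, toPSL_matA_zpow hp] at hk, v, hv, rfl⟩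
  · intro k hk v hv
    rw [Ne, toPSL_matB_zpow hq] at hk
    have g0 := hout v hv 0
    have g1 := hout v hv 1
    have e0 := matB_zpow_mulVec_zero q ρ k v
    have e1 := matB_zpow_mulVec_sub hq ρ k v
    set w := (matB q ρ ^ k).val.mulVec v
    have n0 : ‖w 0‖ = ‖v 0‖ := by rw [e0, norm_mul, norm_expPi_zpow, one_mul]
    -- This is the coordinate 1/z centred at `fixedPointB`, turned by conj (u 0) and multiplied by
    -- ‖v 0‖² so that nothing is divided by v 0. The powers of B rotate y.
    obtain ⟨y, hy⟩ : ∃ y, y = conj (u 0) * (v 1 - fixedPointB q ρ * v 0) * conj (v 0) := ⟨_, rfl⟩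
    have hy' : conj (u 0) * (w 1 - fixedPointB q ρ * w 0) * conj (w 0) =
        expPi q ^ (-(2 * k)) * y := by
      have hk2 : expPi q ^ (-(2 * k)) = expPi q ^ (-k) * expPi q ^ (-k) := by
        rw [← zpow_add₀ (expPi_ne_zero q)]; congr 1; ring
      rw [e1, e0, hy, map_mul, conj_expPi_zpow, hk2]; ring
    have hu1 : conj (u 1) = -(expPi q ^ (-2 : ℤ)) * conj (u 0) := by
      rw [hu01, map_mul, map_neg, conj_expPi_zpow]
    have split : ∀ (c : ℂ) (v : Fin 2 → ℂ), (c * v 1 * conj (v 0)).re =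
        (c * (v 1 - fixedPointB q ρ * v 0) * conj (v 0)).re +
          (c * fixedPointB q ρ).re * ‖v 0‖ ^ 2 := by
      intro c v
      have : c * v 1 * conj (v 0) = c * (v 1 - fixedPointB q ρ * v 0) * conj (v 0) +
          (c * fixedPointB q ρ) * ((‖v 0‖ ^ 2 : ℝ) : ℂ) := by
        push_cast
        rw [← Complex.mul_conj']; ring
      rw [this, Complex.add_re, Complex.re_mul_ofReal]
    have cv : ∀ v : Fin 2 → ℂ, conj (u 1) * (v 1 - fixedPointB q ρ * v 0) * conj (v 0) =
        -(expPi q ^ (-2 : ℤ) * (conj (u 0) * (v 1 - fixedPointB q ρ * v 0) * conj (v 0))) := by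
      intro v; rw [hu1]; ring
    rw [split, ← hy] at g0
    rw [split, cv, ← hy, Complex.neg_re] at g1
    have := pinwheel hq hk (y := y) (τ := (t 0 - (conj (u 0) * fixedPointB q ρ).re) * ‖v 0‖ ^ 2)
      (τ' := -((t 1 - (conj (u 1) * fixedPointB q ρ).re) * ‖v 0‖ ^ 2))
      (by nlinarith [sq_nonneg ‖v 0‖]) (by linarith) (by linarith)
    rcases this with h | h
    · refine ⟨0, ?_⟩
      rw [norm_sub_disc_lt_iff (hu 0) (ht 0), split, hy', n0]
      linarith
    · refine ⟨1, ?_⟩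
      rw [norm_sub_disc_lt_iff (hu 1) (ht 1), split, cv, hy', n0, Complex.neg_re,
        mul_left_comm (expPi q ^ (-2 : ℤ))]
      linarith
  · have hcont : ∀ i j, Continuous fun M : SL(2, ℂ) => M.val i j := fun i j =>
      continuous_subtype_val.matrix_elem i j
    have h00 := hcont 0 0
    have h10 := hcont 1 0
    exact (isOpen_lt (f := fun M : SL(2, ℂ) => |(M.val 0 0).im|) (by fun_prop)
      continuous_const).inter (isOpen_lt (f := fun M : SL(2, ℂ) => C * ‖M.val 1 0‖) (by fun_prop)
      (by fun_prop))
  · refine ⟨?_, ?_⟩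
    · simpa using sin_pi_div_pos hp
    · simp
  · rintro M ⟨-, hM⟩ h
    have hle : (1 / t 0 + 1 / t 1) * ‖M.val 1 0‖ ≤ C * ‖M.val 1 0‖ := by
      apply mul_le_mul_of_nonneg_right _ (norm_nonneg _)
      rw [hC]; linarith [norm_nonneg (fixedPointA p)]
    have e0 : M.val.mulVec ![1, 0] 0 = M.val 0 0 := by simp
    have e1 : M.val.mulVec ![1, 0] 1 = M.val 1 0 := by simp
    rcases h with h | h
    · have := hSC _ h
      rw [e0, e1] at this
      linarith
    · have := hTC _ h
      rw [e0, e1] at this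
      linarith
  · rintro M ⟨hM, -⟩ k hk
    rw [hk, toPSL_matA_zpow hp]
    by_contra hpk
    have h1 := sin_pi_div_le_abs_sin (by omega) hpk
    have h3 := matA_zpow_mulVec_sub hp k ![1, 0]
    rw [matA_zpow_mulVec_one] at h3
    have h4 : (matA p ^ k).val 0 0 = expPi p ^ k := by simpa using h3
    rw [← h4] at h1
    rcases toPSL_eq_iff.mp hk with rfl | rfl
    · linarith
    · rw [Matrix.SpecialLinearGroup.coe_neg, Matrix.neg_apply, Complex.neg_im, abs_neg] at hM
      linarith

/-! ### From disjoint discs to half-planes of parameters -/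

theorem conj_expPi (n : ℕ) : conj (expPi n) = (expPi n)⁻¹ := by
  have := conj_expPi_zpow n 1
  rwa [zpow_one, zpow_neg_one] at this

/-- Ping-pong for all parameters in a half-plane with inner normal `d`. The two discs of the
generator `matB q ρ` have radii `1 / 2t₁` and `1 / 2t₂`. -/
theorem pingPong_of_halfPlane {p q : ℕ} (hp : 2 ≤ p) (hq : 2 ≤ q) {ρ d : ℂ} (hd : ‖d‖ = 1)
    {t₁ t₂ : ℝ} (ht₁ : 0 < t₁) (ht₂ : 0 < t₂) (hsum : t₁ + t₂ ≤ (ρ * conj d).re)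
    (h1 : 1 ≤ ‖Real.sin (Real.pi / p) * expPi q - Complex.I * t₁ * d‖)
    (h2 : 1 ≤ ‖Real.sin (Real.pi / p) * (expPi q)⁻¹ + Complex.I * t₂ * d‖)
    (h3 : t₁ + t₂ ≤ ‖t₂ * (expPi p * expPi q) + t₁ * ((expPi p)⁻¹ * (expPi q)⁻¹) +
      2 * t₁ * t₂ * d‖)
    (h4 : t₁ + t₂ ≤ ‖t₂ * ((expPi p)⁻¹ * expPi q) + t₁ * (expPi p * (expPi q)⁻¹) -
      2 * t₁ * t₂ * d‖) :
    PingPong (matA p) (matB q ρ) := by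
  have hp0 := expPi_ne_zero p
  have hq0 := expPi_ne_zero q
  have hfp := fixedPointA_mul hp
  have hsin : (expPi p)⁻¹ = expPi p - 2 * Complex.I * Real.sin (Real.pi / p) := by
    rw [expPi_inv_eq, expPi_eq]; ring
  have hdd : d * conj d = 1 := by rw [Complex.mul_conj', hd]; simp
  have c₁ : (t₁ : ℂ) ≠ 0 := by exact_mod_cast ht₁.ne'
  have c₂ : (t₂ : ℂ) ≠ 0 := by exact_mod_cast ht₂.ne'
  have hu : ∀ i, ‖(![d * (expPi q)⁻¹, -d * expPi q] : Fin 2 → ℂ) i‖ = 1 := by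
    intro i; fin_cases i <;> simp [hd, norm_expPi]
  have ht : ∀ i, 0 < (![t₁, t₂] : Fin 2 → ℝ) i := by
    intro i; fin_cases i <;> simp [ht₁, ht₂]
  -- With β = `expPi q` the conjugates of the two directions add up to d̄(β − β⁻¹), and
  -- `fixedPointB` times β − β⁻¹ is ρ. This turns the sector condition into Re(ρ d̄) ≥ t₁ + t₂.
  refine pingPong_of_disjoint_rotations hp hq (u := ![d * (expPi q)⁻¹, -d * expPi q])
    (t := ![t₁, t₂]) hu ht ?_ ?_ ?_
  · simp only [Matrix.cons_val_one, Matrix.cons_val_zero, Matrix.cons_val_fin_one]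
    rw [zpow_ofNat]
    field_simp
  · have hB := fixedPointB_mul hq ρ
    simp only [Matrix.cons_val_one, Matrix.cons_val_zero, Matrix.cons_val_fin_one]
    rw [← Complex.add_re, map_mul, map_mul, map_neg, map_inv₀, conj_expPi, inv_inv]
    have : conj d * expPi q * fixedPointB q ρ + -conj d * (expPi q)⁻¹ * fixedPointB q ρ =
        ρ * conj d := by linear_combination conj d * hB
    rw [this]
    exact hsum
  have x₁ : conj (d * (expPi q)⁻¹) = conj d * expPi q := by
    rw [map_mul, map_inv₀, conj_expPi, inv_inv]
  have x₂ : conj (-d * expPi q) = -(conj d * (expPi q)⁻¹) := by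
    rw [map_mul, map_neg, conj_expPi]; ring
  obtain ⟨z₁, hz₁⟩ : ∃ z, z = conj d * expPi q / (2 * t₁) - fixedPointA p := ⟨_, rfl⟩
  obtain ⟨z₂, hz₂⟩ : ∃ z, z = -(conj d * (expPi q)⁻¹) / (2 * t₂) - fixedPointA p := ⟨_, rfl⟩
  -- Rotating one disc against the other is the inverse rotation with their roles exchanged, so `g1`
  -- to `g4` cover all pairs and both directions.
  have swap : ∀ (m n : ℤ) (z z' : ℂ), m + n = 0 →
      ‖expPi p ^ m * z - z'‖ = ‖expPi p ^ n * z' - z‖ := by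
    intro m n z z' h
    have : expPi p ^ m * z - z' = -(expPi p ^ m) * (expPi p ^ n * z' - z) := by
      have h1 : expPi p ^ m * expPi p ^ n = 1 := by rw [← zpow_add₀ hp0, h, zpow_zero]
      linear_combination z' * h1
    rw [this, norm_mul, norm_neg, norm_expPi_zpow, one_mul]
  have nE := norm_expPi p
  have nE' : ‖(expPi p)⁻¹‖ = 1 := by rw [norm_inv, nE, inv_one]
  have nd : ‖conj d‖ = 1 := by rw [Complex.norm_conj, hd]
  have hEE : expPi p * (expPi p)⁻¹ = 1 := mul_inv_cancel₀ hp0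
  have zneg : expPi p ^ (-2 : ℤ) = (expPi p)⁻¹ ^ 2 := by rw [zpow_neg, inv_pow]; rfl
  obtain ⟨τ₁, hτ₁⟩ : ∃ τ : ℝ, τ = 1 / (2 * t₁) := ⟨_, rfl⟩
  obtain ⟨τ₂, hτ₂⟩ : ∃ τ : ℝ, τ = 1 / (2 * t₂) := ⟨_, rfl⟩
  have pτ₁ : 0 < τ₁ := by rw [hτ₁]; positivity
  have pτ₂ : 0 < τ₂ := by rw [hτ₂]; positivity
  have r₁ : 2 * t₁ * τ₁ = 1 := by rw [hτ₁]; field_simp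
  have r₂ : 2 * t₂ * τ₂ = 1 := by rw [hτ₂]; field_simp
  have e₁ : 2 * (t₁ : ℂ) * τ₁ = 1 := by exact_mod_cast r₁
  have e₂ : 2 * (t₂ : ℂ) * τ₂ = 1 := by exact_mod_cast r₂
  have hz₁' := hz₁
  have hz₂' := hz₂
  replace hz₁ : z₁ = conj d * expPi q * τ₁ - fixedPointA p := by
    rw [hz₁, hτ₁]; push_cast; ring
  replace hz₂ : z₂ = -(conj d * (expPi q)⁻¹) * τ₂ - fixedPointA p := by
    rw [hz₂, hτ₂]; push_cast; ring
  have g1 : τ₁ + τ₁ ≤ ‖expPi p ^ (2 : ℤ) * z₁ - z₁‖ := by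
    have : expPi p ^ (2 : ℤ) * z₁ - z₁ = expPi p * conj d * Complex.I *
        (Real.sin (Real.pi / p) * expPi q - Complex.I * t₁ * d) * ((2 * τ₁ : ℝ) : ℂ) := by
      rw [hz₁, zpow_ofNat]
      simp only [Complex.ofReal_mul, Complex.ofReal_ofNat]
      linear_combination (-(conj d * expPi q * τ₁ * expPi p)) * hsin +
        (conj d * expPi q * τ₁ - fixedPointA p) * hEE + expPi p * hfp +
        expPi p * d * conj d * 2 * t₁ * τ₁ * Complex.I_sq - expPi p * 2 * t₁ * τ₁ * hdd -
        expPi p * e₁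
    rw [this, norm_mul, norm_mul, norm_mul, norm_mul, nE, nd, Complex.norm_I, Complex.norm_real,
      Real.norm_eq_abs, abs_of_pos (by positivity)]
    nlinarith
  have g2 : τ₂ + τ₂ ≤ ‖expPi p ^ (2 : ℤ) * z₂ - z₂‖ := by
    have : expPi p ^ (2 : ℤ) * z₂ - z₂ = -(expPi p * conj d * Complex.I *
        (Real.sin (Real.pi / p) * (expPi q)⁻¹ + Complex.I * t₂ * d) * ((2 * τ₂ : ℝ) : ℂ)) := by
      rw [hz₂, zpow_ofNat]
      simp only [Complex.ofReal_mul, Complex.ofReal_ofNat]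
      linear_combination (conj d * (expPi q)⁻¹ * τ₂ * expPi p) * hsin +
        (-(conj d * (expPi q)⁻¹ * τ₂) - fixedPointA p) * hEE + expPi p * hfp +
        expPi p * d * conj d * 2 * t₂ * τ₂ * Complex.I_sq - expPi p * 2 * t₂ * τ₂ * hdd -
        expPi p * e₂
    rw [this, norm_neg, norm_mul, norm_mul, norm_mul, norm_mul, nE, nd, Complex.norm_I,
      Complex.norm_real, Real.norm_eq_abs, abs_of_pos (by positivity)]
    nlinarith
  have hττ : τ₁ + τ₂ = (t₁ + t₂) * (2 * τ₁ * τ₂) := by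
    linear_combination -τ₂ * r₁ - τ₁ * r₂
  have g3 : τ₁ + τ₂ ≤ ‖expPi p ^ (2 : ℤ) * z₁ - z₂‖ := by
    have : expPi p ^ (2 : ℤ) * z₁ - z₂ = expPi p * conj d * (t₂ * (expPi p * expPi q) +
        t₁ * ((expPi p)⁻¹ * (expPi q)⁻¹) + 2 * t₁ * t₂ * d) * ((2 * τ₁ * τ₂ : ℝ) : ℂ) := by
      rw [hz₁, hz₂, zpow_ofNat]
      simp only [Complex.ofReal_mul, Complex.ofReal_ofNat]
      linear_combination (-(expPi p ^ 2 * conj d * expPi q * τ₁)) * e₂ -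
        conj d * (expPi q)⁻¹ * τ₂ * (2 * t₁ * τ₁ * hEE + e₁) + expPi p * hfp -
        fixedPointA p * hEE -
        expPi p * (2 * t₁ * τ₁ * (2 * t₂ * τ₂) * hdd + 2 * t₁ * τ₁ * e₂ + e₁)
    rw [this, norm_mul, norm_mul, norm_mul, nE, nd, Complex.norm_real, Real.norm_eq_abs,
      abs_of_pos (by positivity), hττ, one_mul, one_mul]
    gcongr
  have g4 : τ₁ + τ₂ ≤ ‖expPi p ^ (-2 : ℤ) * z₁ - z₂‖ := by
    have : expPi p ^ (-2 : ℤ) * z₁ - z₂ = (expPi p)⁻¹ * conj d * (t₂ * ((expPi p)⁻¹ * expPi q) +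
        t₁ * (expPi p * (expPi q)⁻¹) - 2 * t₁ * t₂ * d) * ((2 * τ₁ * τ₂ : ℝ) : ℂ) := by
      rw [hz₁, hz₂, zneg]
      simp only [Complex.ofReal_mul, Complex.ofReal_ofNat]
      linear_combination (-((expPi p)⁻¹ ^ 2 * conj d * expPi q * τ₁)) * e₂ -
        conj d * (expPi q)⁻¹ * τ₂ * (2 * t₁ * τ₁ * hEE + e₁) - (expPi p)⁻¹ * hfp -
        fixedPointA p * hEE +
        (expPi p)⁻¹ * (2 * t₁ * τ₁ * (2 * t₂ * τ₂) * hdd + 2 * t₁ * τ₁ * e₂ + e₁)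
    rw [this, norm_mul, norm_mul, norm_mul, nE', nd, Complex.norm_real, Real.norm_eq_abs,
      abs_of_pos (by positivity), hττ, one_mul, one_mul]
    gcongr
  intro k hk i j
  apply le_norm_rotate_sub hp hk
  · have := ht i
    have := ht j
    positivity
  · have hn : ∀ i, ‖conj ((![d * (expPi q)⁻¹, -d * expPi q] : Fin 2 → ℂ) i) /
        (2 * ((![t₁, t₂] : Fin 2 → ℝ) i : ℂ))‖ = 1 / (2 * (![t₁, t₂] : Fin 2 → ℝ) i) := by
      intro i
      rw [norm_div, Complex.norm_conj, hu, norm_mul, Complex.norm_real, Real.norm_eq_abs,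
        abs_of_pos (ht i)]
      simp
    rw [sub_sub_sub_cancel_right, ← hn, ← hn]
    exact norm_sub_le _ _
  · fin_cases i <;> fin_cases j <;>
      simp only [Fin.zero_eta, Fin.mk_one, Matrix.cons_val_zero, Matrix.cons_val_one,
        Matrix.cons_val_fin_one, x₁, x₂, ← hz₁', ← hz₂', ← hτ₁, ← hτ₂]
    · exact g1
    · exact g3
    · rw [swap 2 (-2) _ _ (by norm_num), add_comm]; exact g4
    · exact g2
  · fin_cases i <;> fin_cases j <;>
      simp only [Fin.zero_eta, Fin.mk_one, Matrix.cons_val_zero, Matrix.cons_val_one,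
        Matrix.cons_val_fin_one, x₁, x₂, ← hz₁', ← hz₂', ← hτ₁, ← hτ₂]
    · rw [swap (-2) 2 _ _ (by norm_num)]; exact g1
    · exact g4
    · rw [swap (-2) 2 _ _ (by norm_num), add_comm]; exact g3
    · rw [swap (-2) 2 _ _ (by norm_num)]; exact g2

/-! ### The explicit half-planes -/

theorem cos_pi_div_pos {n : ℕ} (hn : 3 ≤ n) : 0 < Real.cos (Real.pi / n) := by
  have h3 : (3 : ℝ) ≤ n := by exact_mod_cast hn
  have hpi := Real.pi_pos
  apply Real.cos_pos_of_mem_Ioo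
  constructor
  · have : 0 < Real.pi / n := by positivity
    linarith
  · rw [div_lt_div_iff₀ (by positivity) two_pos]; nlinarith

theorem re_expPi (n : ℕ) : (expPi n).re = Real.cos (Real.pi / n) := by
  rw [expPi_eq]; simp [-Complex.ofReal_cos, -Complex.ofReal_sin]

theorem im_expPi (n : ℕ) : (expPi n).im = Real.sin (Real.pi / n) := by
  rw [expPi_eq]; simp [-Complex.ofReal_cos, -Complex.ofReal_sin]

theorem le_norm_of_sq_le {r : ℝ} {z : ℂ} (h : r ^ 2 ≤ z.re ^ 2 + z.im ^ 2) : r ≤ ‖z‖ := by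
  apply le_of_sq_le_sq _ (norm_nonneg z)
  rwa [← Complex.normSq_eq_norm_sq, Complex.normSq_apply, ← sq, ← sq]

/-- Ping-pong for the half-plane whose boundary line has `x + i y` as the foot of the perpendicular
from the origin. -/
theorem pingPong_of_foot {p q : ℕ} (hp : 2 ≤ p) (hq : 2 ≤ q) {ρ : ℂ} {x y : ℝ}
    (hxy : 0 < x ^ 2 + y ^ 2) (hρ : x ^ 2 + y ^ 2 ≤ ρ.re * x + ρ.im * y)
    (h1 : 4 ≤ (x - 2 * Real.sin (Real.pi / p) * Real.sin (Real.pi / q)) ^ 2 +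
      (y + 2 * Real.sin (Real.pi / p) * Real.cos (Real.pi / q)) ^ 2)
    (h2 : 4 ≤ (x - 2 * Real.sin (Real.pi / p) * Real.sin (Real.pi / q)) ^ 2 +
      (y - 2 * Real.sin (Real.pi / p) * Real.cos (Real.pi / q)) ^ 2)
    (h3 : 4 ≤ (x + 2 * Real.cos (Real.pi / p + Real.pi / q)) ^ 2 + y ^ 2)
    (h4 : 4 ≤ (x - 2 * Real.cos (Real.pi / p - Real.pi / q)) ^ 2 + y ^ 2) :
    PingPong (matA p) (matB q ρ) := by
  obtain ⟨n, hn⟩ : ∃ n, n = √(x ^ 2 + y ^ 2) := ⟨_, rfl⟩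
  have hn2 : n ^ 2 = x ^ 2 + y ^ 2 := by rw [hn, Real.sq_sqrt hxy.le]
  have hn0 : 0 < n := by rw [hn]; exact Real.sqrt_pos.mpr hxy
  -- With equal radii, 2td is the foot itself, and each of the four disjointness conditions says
  -- that the foot has distance at least 2 from a fixed centre.
  obtain ⟨t, ht⟩ : ∃ t, t = n / 2 := ⟨_, rfl⟩
  have ht0 : 0 < t := by rw [ht]; positivity
  obtain ⟨d, hd⟩ : ∃ d : ℂ, d = ⟨x / n, y / n⟩ := ⟨_, rfl⟩
  have hx : 2 * t * d.re = x := by rw [ht, hd]; field_simp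
  have hy : 2 * t * d.im = y := by rw [ht, hd]; field_simp
  have hnd : ‖d‖ = 1 := by
    rw [← sq_eq_sq₀ (norm_nonneg _) zero_le_one, ← Complex.normSq_eq_norm_sq, Complex.normSq_apply,
      hd]
    field_simp
    linarith
  refine pingPong_of_halfPlane hp hq hnd ht0 ht0 ?_ ?_ ?_ ?_ ?_
  · rw [Complex.mul_re, Complex.conj_re, Complex.conj_im, hd, ht]
    have : n ^ 2 ≤ ρ.re * x + ρ.im * y := by rw [hn2]; exact hρ
    have e : ρ.re * (x / n) - ρ.im * -(y / n) = (ρ.re * x + ρ.im * y) / n := by ring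
    rw [e, le_div_iff₀ hn0]
    linarith
  · apply le_norm_of_sq_le
    have a1 : (Real.sin (Real.pi / p) * expPi q - Complex.I * t * d).re =
        Real.sin (Real.pi / p) * Real.cos (Real.pi / q) + t * d.im := by
      rw [Complex.sub_re, Complex.re_ofReal_mul, re_expPi]; simp
    have a2 : (Real.sin (Real.pi / p) * expPi q - Complex.I * t * d).im =
        Real.sin (Real.pi / p) * Real.sin (Real.pi / q) - t * d.re := by
      rw [Complex.sub_im, Complex.im_ofReal_mul, im_expPi]; simp
    rw [a1, a2]
    rw [← hx, ← hy] at h1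
    linarith
  · apply le_norm_of_sq_le
    have a1 : (Real.sin (Real.pi / p) * (expPi q)⁻¹ + Complex.I * t * d).re =
        Real.sin (Real.pi / p) * Real.cos (Real.pi / q) - t * d.im := by
      rw [Complex.add_re, Complex.re_ofReal_mul, ← conj_expPi, Complex.conj_re, re_expPi]; simp; ring
    have a2 : (Real.sin (Real.pi / p) * (expPi q)⁻¹ + Complex.I * t * d).im =
        -(Real.sin (Real.pi / p) * Real.sin (Real.pi / q)) + t * d.re := by
      rw [Complex.add_im, Complex.im_ofReal_mul, ← conj_expPi, Complex.conj_im, im_expPi]; simp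
    rw [a1, a2]
    rw [← hx, ← hy] at h2
    linarith
  · apply le_norm_of_sq_le
    have e : (t * (expPi p * expPi q) + t * ((expPi p)⁻¹ * (expPi q)⁻¹) + 2 * t * t * d : ℂ) =
        (t : ℂ) * ((expPi p * expPi q + (expPi p)⁻¹ * (expPi q)⁻¹) + ((2 * t : ℝ) : ℂ) * d) := by
      push_cast; ring
    rw [e, Complex.re_ofReal_mul, Complex.im_ofReal_mul, Complex.add_re, Complex.add_im,
      Complex.re_ofReal_mul, Complex.im_ofReal_mul, hx, hy, ← conj_expPi, ← conj_expPi, ← map_mul,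
      Complex.add_conj, Complex.ofReal_re, Complex.ofReal_im, Complex.mul_re, re_expPi, re_expPi,
      im_expPi, im_expPi, ← Real.cos_add]
    have := mul_le_mul_of_nonneg_left h3 (sq_nonneg t)
    linarith
  · apply le_norm_of_sq_le
    have e : (t * ((expPi p)⁻¹ * expPi q) + t * (expPi p * (expPi q)⁻¹) - 2 * t * t * d : ℂ) =
        (t : ℂ) * ((expPi p * (expPi q)⁻¹ + (expPi p)⁻¹ * expPi q) - ((2 * t : ℝ) : ℂ) * d) := by
      push_cast; ring
    have e2 : expPi p * (expPi q)⁻¹ + (expPi p)⁻¹ * expPi q =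
        ((2 * Real.cos (Real.pi / p - Real.pi / q) : ℝ) : ℂ) := by
      rw [← conj_expPi, ← conj_expPi]
      have : conj (expPi p) * expPi q = conj (expPi p * conj (expPi q)) := by
        rw [map_mul, Complex.conj_conj]
      rw [this, Complex.add_conj, Complex.mul_re, Complex.conj_re, Complex.conj_im, re_expPi,
        re_expPi, im_expPi, im_expPi, Real.cos_sub]
      congr 1; ring
    rw [e, e2, Complex.re_ofReal_mul, Complex.im_ofReal_mul, Complex.sub_re, Complex.sub_im,
      Complex.re_ofReal_mul, Complex.im_ofReal_mul, hx, hy, Complex.ofReal_re, Complex.ofReal_im]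
    have := mul_le_mul_of_nonneg_left h4 (sq_nonneg t)
    linarith

/-- The foot is the rightmost point of the circle of radius 2 about 2 cos(π/p − π/q), so the last
condition is an equality. -/
theorem pingPong_of_le_re {p q : ℕ} (hp : 3 ≤ p) (hq : 3 ≤ q) {ρ : ℂ}
    (hρ : 2 + 2 * Real.cos (Real.pi / p - Real.pi / q) ≤ ρ.re) :
    PingPong (matA p) (matB q ρ) := by
  have hC := cos_pi_div_pos hp
  have hc := cos_pi_div_pos hq
  have hS := sin_pi_div_pos (n := p) (by omega)
  have hs := sin_pi_div_pos (n := q) (by omega)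
  have hCc := mul_pos hC hc
  have hSs := mul_pos hS hs
  rw [Real.cos_sub] at hρ
  refine pingPong_of_foot (by omega) (by omega)
    (x := 2 + 2 * Real.cos (Real.pi / p - Real.pi / q)) (y := 0) ?_ ?_ ?_ ?_ ?_ ?_ <;>
    rw [Real.cos_sub] <;> try rw [Real.cos_add]
  all_goals
    set C := Real.cos (Real.pi / p)
    set c := Real.cos (Real.pi / q)
    set S := Real.sin (Real.pi / p)
    set s := Real.sin (Real.pi / q)
  · positivity
  · nlinarith [mul_nonneg (by linarith : 0 ≤ 2 + 2 * (C * c + S * s)) (sub_nonneg.mpr hρ)]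
  · nlinarith [sq_nonneg (2 * S * c)]
  · nlinarith [sq_nonneg (2 * S * c)]
  · nlinarith
  · apply le_of_eq; ring

theorem xi_sq (n : ℕ) : xi n ^ 2 = 12 + 4 * Real.sin (Real.pi / n) ^ 2 := by
  have : 0 ≤ 7 - Real.cos (2 * Real.pi / n) := by
    linarith [Real.cos_le_one (2 * Real.pi / n)]
  rw [xi, mul_pow, Real.sq_sqrt (by norm_num), Real.sq_sqrt this, mul_div_assoc, Real.cos_two_mul,
    Real.cos_sq']
  ring

theorem xi_pos (n : ℕ) : 0 < xi n := by
  have : 0 < 7 - Real.cos (2 * Real.pi / n) := by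
    linarith [Real.cos_le_one (2 * Real.pi / n)]
  rw [xi]; positivity

/-- The point ρ*_{q,p} lies on two of the four circles of radius 2: those about 2 cos(π/p − π/q) and
about 2 sin(π/p)(sin(π/q) + i cos(π/q)). Conjugating the foot only interchanges the first two
conditions of `pingPong_of_foot`. -/
theorem pingPong_of_rhoStar {p q : ℕ} (hp : 3 ≤ p) (hq : 3 ≤ q) {ρ : ℂ} {y : ℝ}
    (hy : y = (rhoStar q p).im ∨ y = -(rhoStar q p).im)
    (hρ : (rhoStar q p).re ^ 2 + y ^ 2 ≤ ρ.re * (rhoStar q p).re + ρ.im * y) :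
    PingPong (matA p) (matB q ρ) := by
  have hC := cos_pi_div_pos hp
  have hc := cos_pi_div_pos hq
  have hS := sin_pi_div_pos (n := p) (by omega)
  have hs := sin_pi_div_pos (n := q) (by omega)
  have hx := xi_pos q
  have hx2 := xi_sq q
  have p1 := Real.sin_sq_add_cos_sq (Real.pi / p)
  have p2 := Real.sin_sq_add_cos_sq (Real.pi / q)
  have hy2 : y ^ 2 = (rhoStar q p).im ^ 2 := by rcases hy with rfl | rfl <;> ring
  have hre : (rhoStar q p).re = Real.cos (Real.pi / q) * Real.cos (Real.pi / p) +
    1 / 2 * Real.sin (Real.pi / p) * (4 * Real.sin (Real.pi / q) + xi q) := rfl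
  have him : (rhoStar q p).im = xi q / 2 * Real.cos (Real.pi / p) +
    Real.cos (Real.pi / q) * Real.sin (Real.pi / p) := rfl
  have hre0 : 0 < (rhoStar q p).re := by rw [hre]; positivity
  have him0 : 0 < (rhoStar q p).im := by rw [him]; positivity
  have key : ((rhoStar q p).re - 2 * Real.sin (Real.pi / p) * Real.sin (Real.pi / q)) ^ 2 +
      ((rhoStar q p).im - 2 * Real.sin (Real.pi / p) * Real.cos (Real.pi / q)) ^ 2 = 4 := by
    rw [hre, him]
    linear_combination (xi q ^ 2 / 4 + Real.cos (Real.pi / q) ^ 2) * p1 + 1 / 4 * hx2 + p2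
  have key2 : ((rhoStar q p).re - 2 * Real.sin (Real.pi / p) * Real.sin (Real.pi / q)) ^ 2 +
      ((rhoStar q p).im + 2 * Real.sin (Real.pi / p) * Real.cos (Real.pi / q)) ^ 2 ≥ 4 := by
    have := mul_pos (mul_pos hS hc) him0
    linarith
  have key3 : ((rhoStar q p).re - 2 * Real.cos (Real.pi / p - Real.pi / q)) ^ 2 +
      (rhoStar q p).im ^ 2 = 4 := by
    rw [hre, him, Real.cos_sub]
    linear_combination (xi q ^ 2 / 4 + Real.cos (Real.pi / q) ^ 2) * p1 + 1 / 4 * hx2 + p2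
  refine pingPong_of_foot (by omega) (by omega) (x := (rhoStar q p).re) (y := y)
    (by positivity) hρ ?_ ?_ ?_ ?_
  · rcases hy with rfl | rfl
    · exact key2
    · apply le_of_eq; rw [← key]; ring
  · rcases hy with rfl | rfl
    · exact key.ge
    · apply le_trans key2.le; apply le_of_eq; ring
  · rw [hy2, ← key3, Real.cos_sub, Real.cos_add]
    have h0 : 0 ≤ (rhoStar q p).re - 2 * (Real.sin (Real.pi / p) * Real.sin (Real.pi / q)) := by
      rw [hre]
      have := mul_pos hc hC
      have := mul_pos hS hx
      linarith
    have := mul_nonneg (mul_pos hC hc).le h0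
    linarith
  · rw [hy2, key3]

/-- In the direction d = i the best discs have unequal radii. The values r ∓ Sc make each disc
tangent to its own rotates (`h1` and `h2` are equalities), and they add up to the required height
2r. In the two mixed conditions the squares differ by (2Cc)². -/
theorem pingPong_of_le_im {p q : ℕ} (hp : 3 ≤ p) (hq : 3 ≤ q) {ρ : ℂ}
    (hρ : 2 * √(1 - Real.sin (Real.pi / p) ^ 2 * Real.sin (Real.pi / q) ^ 2) ≤ ρ.im) :
    PingPong (matA p) (matB q ρ) := by
  have hC := cos_pi_div_pos hp
  have hc := cos_pi_div_pos hq
  have hS := sin_pi_div_pos (n := p) (by omega)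
  have hs := sin_pi_div_pos (n := q) (by omega)
  have p1 := Real.sin_sq_add_cos_sq (Real.pi / p)
  have p2 := Real.sin_sq_add_cos_sq (Real.pi / q)
  have rp := re_expPi p
  have rq := re_expPi q
  have ip := im_expPi p
  have iq := im_expPi q
  have rp' : ((expPi p)⁻¹).re = Real.cos (Real.pi / p) := by rw [← conj_expPi, Complex.conj_re, rp]
  have rq' : ((expPi q)⁻¹).re = Real.cos (Real.pi / q) := by rw [← conj_expPi, Complex.conj_re, rq]
  have ip' : ((expPi p)⁻¹).im = -Real.sin (Real.pi / p) := by
    rw [← conj_expPi, Complex.conj_im, ip]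
  have iq' : ((expPi q)⁻¹).im = -Real.sin (Real.pi / q) := by
    rw [← conj_expPi, Complex.conj_im, iq]
  generalize Real.cos (Real.pi / p) = C at *
  generalize Real.cos (Real.pi / q) = c at *
  generalize hSS : Real.sin (Real.pi / p) = S at *
  generalize Real.sin (Real.pi / q) = s at *
  obtain ⟨r, hr⟩ : ∃ r, r = √(1 - S ^ 2 * s ^ 2) := ⟨_, rfl⟩
  have hr2 : r ^ 2 = C ^ 2 + S ^ 2 * c ^ 2 := by
    rw [hr, Real.sq_sqrt (by nlinarith [sq_nonneg (S * c), sq_nonneg C])]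
    linear_combination -p1 - S ^ 2 * p2
  have hr0 : 0 ≤ r := by rw [hr]; positivity
  have hrS : S * c < r := by
    apply lt_of_pow_lt_pow_left₀ 2 hr0
    nlinarith [sq_pos_of_pos hC]
  rw [← hr] at hρ
  have hSc := mul_pos hS hc
  have hCc := mul_pos hC hc
  refine pingPong_of_halfPlane (by omega) (by omega) (d := Complex.I) (t₁ := r - S * c)
    (t₂ := r + S * c) (by simp) (by linarith) (by linarith) ?_ ?_ ?_ ?_ ?_
  · simp; linarith
  · rw [hSS]
    have e1 : (S * expPi q - Complex.I * ((r - S * c : ℝ) : ℂ) * Complex.I).re = r := by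
      simp [rq, -Complex.ofReal_sub]
    have e2 : (S * expPi q - Complex.I * ((r - S * c : ℝ) : ℂ) * Complex.I).im = S * s := by
      simp [iq, -Complex.ofReal_sub]
    apply le_norm_of_sq_le
    rw [e1, e2]
    apply le_of_eq
    grind
  · rw [hSS]
    have e1 : (S * (expPi q)⁻¹ + Complex.I * ((r + S * c : ℝ) : ℂ) * Complex.I).re = -r := by
      rw [Complex.add_re, Complex.re_ofReal_mul, rq']
      simp [-Complex.ofReal_add]
    have e2 : (S * (expPi q)⁻¹ + Complex.I * ((r + S * c : ℝ) : ℂ) * Complex.I).im = -(S * s) := by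
      rw [Complex.add_im, Complex.im_ofReal_mul, iq']
      simp [-Complex.ofReal_add]
    apply le_norm_of_sq_le
    rw [e1, e2]
    apply le_of_eq
    grind
  · have e1 : (((r + S * c : ℝ) : ℂ) * (expPi p * expPi q) +
        ((r - S * c : ℝ) : ℂ) * ((expPi p)⁻¹ * (expPi q)⁻¹) +
        2 * ((r - S * c : ℝ) : ℂ) * ((r + S * c : ℝ) : ℂ) * Complex.I).re =
        2 * r * (C * c - S * s) := by
      rw [Complex.add_re, Complex.add_re, Complex.re_ofReal_mul, Complex.re_ofReal_mul,
        Complex.mul_re, Complex.mul_re (expPi p)⁻¹, rp, rq, ip, iq, rp', rq', ip', iq']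
      simp [-Complex.ofReal_add, -Complex.ofReal_sub]
      ring
    have e2 : (((r + S * c : ℝ) : ℂ) * (expPi p * expPi q) +
        ((r - S * c : ℝ) : ℂ) * ((expPi p)⁻¹ * (expPi q)⁻¹) +
        2 * ((r - S * c : ℝ) : ℂ) * ((r + S * c : ℝ) : ℂ) * Complex.I).im =
        2 * (S * c) * (C * s + S * c) + 2 * (r ^ 2 - (S * c) ^ 2) := by
      rw [Complex.add_im, Complex.add_im, Complex.im_ofReal_mul, Complex.im_ofReal_mul,
        Complex.mul_im, Complex.mul_im (expPi p)⁻¹, rp, rq, ip, iq, rp', rq', ip', iq']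
      simp [-Complex.ofReal_add, -Complex.ofReal_sub]
      ring
    apply le_norm_of_sq_le
    rw [e1, e2, ← sub_nonneg]
    have : (2 * r * (C * c - S * s)) ^ 2 + (2 * (S * c) * (C * s + S * c) +
        2 * (r ^ 2 - (S * c) ^ 2)) ^ 2 - (r - S * c + (r + S * c)) ^ 2 = (2 * (C * c)) ^ 2 := by
      grind
    rw [this]
    positivity
  · have e1 : (((r + S * c : ℝ) : ℂ) * ((expPi p)⁻¹ * expPi q) +
        ((r - S * c : ℝ) : ℂ) * (expPi p * (expPi q)⁻¹) -
        2 * ((r - S * c : ℝ) : ℂ) * ((r + S * c : ℝ) : ℂ) * Complex.I).re =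
        2 * r * (C * c + S * s) := by
      rw [Complex.sub_re, Complex.add_re, Complex.re_ofReal_mul, Complex.re_ofReal_mul,
        Complex.mul_re, Complex.mul_re (expPi p), rp, rq, ip, iq, rp', rq', ip', iq']
      simp [-Complex.ofReal_add, -Complex.ofReal_sub]
      ring
    have e2 : (((r + S * c : ℝ) : ℂ) * ((expPi p)⁻¹ * expPi q) +
        ((r - S * c : ℝ) : ℂ) * (expPi p * (expPi q)⁻¹) -
        2 * ((r - S * c : ℝ) : ℂ) * ((r + S * c : ℝ) : ℂ) * Complex.I).im =
        2 * (S * c) * (C * s - S * c) - 2 * (r ^ 2 - (S * c) ^ 2) := by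
      rw [Complex.sub_im, Complex.add_im, Complex.im_ofReal_mul, Complex.im_ofReal_mul,
        Complex.mul_im, Complex.mul_im (expPi p), rp, rq, ip, iq, rp', rq', ip', iq']
      simp [-Complex.ofReal_add, -Complex.ofReal_sub]
      ring
    apply le_norm_of_sq_le
    rw [e1, e2, ← sub_nonneg]
    have : (2 * r * (C * c + S * s)) ^ 2 + (2 * (S * c) * (C * s - S * c) -
        2 * (r ^ 2 - (S * c) ^ 2)) ^ 2 - (r - S * c + (r + S * c)) ^ 2 = (2 * (C * c)) ^ 2 := by
      grind
    rw [this]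
    positivity

/-! ### Traces and normal forms -/

theorem trace_commutator (X Y : SL(2, ℂ)) :
    (X * Y * X⁻¹ * Y⁻¹).val.trace = X.val.trace ^ 2 + Y.val.trace ^ 2 + (X * Y).val.trace ^ 2 -
      X.val.trace * Y.val.trace * (X * Y).val.trace - 2 := by
  have hX := X.det_coe
  have hY := Y.det_coe
  rw [Matrix.det_fin_two] at hX hY
  simp only [Matrix.SpecialLinearGroup.coe_mul, Matrix.SpecialLinearGroup.coe_inv,
    Matrix.adjugate_fin_two, Matrix.trace_fin_two, Matrix.mul_apply, Fin.sum_univ_two,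
    Matrix.of_apply, Matrix.cons_val_zero, Matrix.cons_val_one, Matrix.cons_val_fin_one]
  generalize X.val 0 0 = a at *
  generalize X.val 0 1 = b at *
  generalize X.val 1 0 = c at *
  generalize X.val 1 1 = d at *
  generalize Y.val 0 0 = e at *
  generalize Y.val 0 1 = f at *
  generalize Y.val 1 0 = g at *
  generalize Y.val 1 1 = h at *
  linear_combination ((e + h) ^ 2 - 2 * (e * h - f * g)) * hX + ((a + d) ^ 2 - 2) * hY

theorem trace_mul_inv (X Y : SL(2, ℂ)) :
    (X * Y⁻¹).val.trace = X.val.trace * Y.val.trace - (X * Y).val.trace := by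
  simp only [Matrix.SpecialLinearGroup.coe_mul, Matrix.SpecialLinearGroup.coe_inv,
    Matrix.adjugate_fin_two, Matrix.trace_fin_two, Matrix.mul_apply, Fin.sum_univ_two,
    Matrix.of_apply, Matrix.cons_val_zero, Matrix.cons_val_one, Matrix.cons_val_fin_one]
  ring

theorem trace_inv (X : SL(2, ℂ)) : X⁻¹.val.trace = X.val.trace := by
  simp only [Matrix.SpecialLinearGroup.coe_inv, Matrix.adjugate_fin_two, Matrix.trace_fin_two,
    Matrix.of_apply, Matrix.cons_val_zero, Matrix.cons_val_one, Matrix.cons_val_fin_one]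
  ring

theorem det_sub_smul_one (X : SL(2, ℂ)) (l : ℂ) :
    (X.val - l • (1 : Matrix (Fin 2) (Fin 2) ℂ)).det = l ^ 2 - X.val.trace * l + 1 := by
  have hX := X.det_coe
  rw [Matrix.det_fin_two] at hX
  rw [Matrix.det_fin_two, Matrix.trace_fin_two]
  simp only [Matrix.sub_apply, Matrix.smul_apply, Matrix.one_apply_eq, smul_eq_mul, mul_one, ne_eq,
    zero_ne_one, one_ne_zero, not_false_eq_true, Matrix.one_apply_ne, mul_zero, sub_zero]
  linear_combination hX

theorem exists_eigenvector_iff (X : SL(2, ℂ)) {l : ℂ} (hl : l ≠ 0) :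
    (∃ v ≠ 0, X.val.mulVec v = l • v) ↔ X.val.trace = l + l⁻¹ := by
  have h1 : (∃ v ≠ 0, X.val.mulVec v = l • v) ↔
      ∃ v ≠ 0, (X.val - l • (1 : Matrix (Fin 2) (Fin 2) ℂ)).mulVec v = 0 := by
    simp only [Matrix.sub_mulVec, Matrix.smul_mulVec, Matrix.one_mulVec, sub_eq_zero]
  rw [h1, Matrix.exists_mulVec_eq_zero_iff, det_sub_smul_one]
  field_simp
  constructor <;> intro h <;> linear_combination -h

/-- The determinant of the matrix with columns `u` and `v`. -/
def colDet (u v : Fin 2 → ℂ) : ℂ := u 0 * v 1 - u 1 * v 0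

theorem colDet_mulVec_add (M : Matrix (Fin 2) (Fin 2) ℂ) (u v : Fin 2 → ℂ) :
    colDet (M.mulVec u) v + colDet u (M.mulVec v) = M.trace * colDet u v := by
  simp only [colDet, Matrix.mulVec, dotProduct, Fin.sum_univ_two, Matrix.trace_fin_two]
  ring

theorem colDet_smul_eq (u v w : Fin 2 → ℂ) (i : Fin 2) :
    colDet u v * w i = colDet w v * u i + colDet u w * v i := by
  fin_cases i <;> simp [colDet] <;> ring

/-- Two elements of `SL(2, ℂ)` without a common fixed point and with the traces of `matA p` and
`matB q ρ` are simultaneously conjugate to them, for a suitable `ρ`. -/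
theorem exists_conj_matA_matB {p q : ℕ} {X Y : SL(2, ℂ)}
    (hX : X.val.trace = expPi p + (expPi p)⁻¹) (hY : Y.val.trace = expPi q + (expPi q)⁻¹) {r : ℂ}
    (hr : (X * Y).val.trace = r + expPi p * expPi q + (expPi p)⁻¹ * (expPi q)⁻¹) (hr0 : r ≠ 0)
    (hr1 : (X * Y).val.trace ≠ expPi p * (expPi q)⁻¹ + (expPi p)⁻¹ * expPi q) :
    ∃ P : SL(2, ℂ), X = P * matA p * P⁻¹ ∧ Y = P * matB q r * P⁻¹ := by
  have hα := expPi_ne_zero p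
  have hβ := expPi_ne_zero q
  obtain ⟨u, hu0, hu⟩ := (exists_eigenvector_iff X hα).mpr hX
  obtain ⟨v, hv0, hv⟩ := (exists_eigenvector_iff Y (inv_ne_zero hβ)).mpr
    (by rw [hY, inv_inv, add_comm])
  have hA : (matA p).val = !![expPi p, 1; 0, (expPi p)⁻¹] := rfl
  have hB : (matB q r).val = !![expPi q, 0; r, (expPi q)⁻¹] := rfl
  have hXY : (X * Y).val = X.val * Y.val := rfl
  generalize expPi p = α at *
  generalize expPi q = β at *
  have hαα : α * α⁻¹ = 1 := mul_inv_cancel₀ hα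
  have hββ : β * β⁻¹ = 1 := mul_inv_cancel₀ hβ
  obtain ⟨D, hD⟩ : ∃ D, D = colDet u v := ⟨_, rfl⟩
  -- If the two eigenvectors were parallel, XY would have the eigenvalue αβ⁻¹, the case excluded by
  -- `hr1`.
  have hD0 : D ≠ 0 := by
    intro h0
    apply hr1
    have : (X * Y).val.trace = α * β⁻¹ + (α * β⁻¹)⁻¹ := by
      rw [← exists_eigenvector_iff _ (mul_ne_zero hα (inv_ne_zero hβ))]
      refine ⟨v, hv0, ?_⟩
      have hXv : X.val.mulVec v = α • v := by
        obtain ⟨i, hi⟩ := Function.ne_iff.mp hu0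
        have hvu : v = (v i / u i) • u := by
          ext j
          simp only [Pi.smul_apply, smul_eq_mul]
          have hi' : u i ≠ 0 := hi
          field_simp
          rw [hD, colDet] at h0
          fin_cases i <;> fin_cases j <;> dsimp <;>
            first | ring1 | linear_combination h0 | linear_combination -h0
        rw [hvu, Matrix.mulVec_smul, hu, smul_comm]
      rw [hXY, ← Matrix.mulVec_mulVec, hv, Matrix.mulVec_smul, hXv, smul_smul, mul_comm]
    rw [this]
    field_simp
  obtain ⟨x, hx⟩ : ∃ x, x = colDet (X.val.mulVec v) v / D := ⟨_, rfl⟩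
  obtain ⟨y, hy⟩ : ∃ y, y = colDet u (Y.val.mulVec u) / D := ⟨_, rfl⟩
  have hXv : ∀ i, X.val.mulVec v i = x * u i + α⁻¹ * v i := by
    intro i
    have h1 := colDet_mulVec_add X.val u v
    have h2 := colDet_smul_eq u v (X.val.mulVec v) i
    have h3 : colDet (X.val.mulVec u) v = α * D := by rw [hu, hD]; simp [colDet]; ring
    have h4 : colDet u (X.val.mulVec v) = α⁻¹ * D := by
      rw [h3, hX, ← hD] at h1; linear_combination h1
    rw [h4, ← hD] at h2
    rw [hx]; field_simp; field_simp at h2; linear_combination h2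
  have hYu : ∀ i, Y.val.mulVec u i = β * u i + y * v i := by
    intro i
    have h1 := colDet_mulVec_add Y.val u v
    have h2 := colDet_smul_eq u v (Y.val.mulVec u) i
    have h3 : colDet u (Y.val.mulVec v) = β⁻¹ * D := by rw [hv, hD]; simp [colDet]; ring
    have h4 : colDet (Y.val.mulVec u) v = β * D := by
      rw [h3, hY, ← hD] at h1; linear_combination h1
    rw [h4, ← hD] at h2
    rw [hy]; field_simp; linear_combination h2
  have hxy : x * y = r := by
    have h1 := colDet_mulVec_add (X * Y).val u v
    have e1 : Y.val.mulVec u = β • u + y • v := by ext i; simpa using hYu i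
    have e2 : X.val.mulVec v = x • u + α⁻¹ • v := by ext i; simpa using hXv i
    rw [hXY, ← Matrix.mulVec_mulVec, ← Matrix.mulVec_mulVec, hv, e1, Matrix.mulVec_add,
      Matrix.mulVec_smul, Matrix.mulVec_smul, Matrix.mulVec_smul, hu, e2, ← hXY, hr, ← hD] at h1
    have e3 : colDet (β • α • u + y • (x • u + α⁻¹ • v)) v + colDet u (β⁻¹ • (x • u + α⁻¹ • v)) =
        (α * β + x * y + α⁻¹ * β⁻¹) * D := by rw [hD]; simp [colDet]; ring
    rw [e3] at h1
    have := mul_right_cancel₀ hD0 h1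
    linear_combination this
  have hx0 : x ≠ 0 := by rintro rfl; simp at hxy; exact hr0 hxy.symm
  -- In the basis μu, lv the upper right entry of X is lx/μ and the determinant is μlD. Making both
  -- equal to 1 forces μ² = x/D.
  obtain ⟨μ, hμ⟩ := IsAlgClosed.exists_pow_nat_eq (x / D) two_pos
  have hux : ∀ i, X.val i 0 * u 0 + X.val i 1 * u 1 = α * u i := by
    intro i
    have := congrFun hu i
    simpa only [Matrix.mulVec, dotProduct, Fin.sum_univ_two, Pi.smul_apply, smul_eq_mul] using this
  have hvy : ∀ i, Y.val i 0 * v 0 + Y.val i 1 * v 1 = β⁻¹ * v i := by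
    intro i
    have := congrFun hv i
    simpa only [Matrix.mulVec, dotProduct, Fin.sum_univ_two, Pi.smul_apply, smul_eq_mul] using this
  simp only [Matrix.mulVec, dotProduct, Fin.sum_univ_two] at hXv hYu
  have hμx : μ ^ 2 * D = x := by rw [hμ]; field_simp
  obtain ⟨l, hl⟩ : ∃ l, l = μ / x := ⟨_, rfl⟩
  have hlx : l * x = μ := by rw [hl]; field_simp
  have hly : μ * y = r * l := by rw [← hxy, ← hlx]; ring
  have hdet : (!![μ * u 0, l * v 0; μ * u 1, l * v 1] : Matrix (Fin 2) (Fin 2) ℂ).det = 1 := by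
    rw [Matrix.det_fin_two_of]
    have : l * x * (μ * D) = x := by rw [hlx]; linear_combination hμx
    have h2 : l * μ * D = 1 := by
      apply mul_right_cancel₀ hx0; linear_combination this
    rw [hD, colDet] at h2
    linear_combination h2
  obtain ⟨Q, hQ⟩ : ∃ Q : SL(2, ℂ), Q.val = !![μ * u 0, l * v 0; μ * u 1, l * v 1] :=
    ⟨⟨_, hdet⟩, rfl⟩
  refine ⟨Q, ?_, ?_⟩
  · rw [eq_mul_inv_iff_mul_eq]
    apply Subtype.ext
    rw [Matrix.SpecialLinearGroup.coe_mul, Matrix.SpecialLinearGroup.coe_mul, hA, hQ]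
    ext i j
    fin_cases i <;> fin_cases j <;>
      simp [Matrix.mul_apply, Fin.sum_univ_two]
    · linear_combination μ * hux 0
    · linear_combination l * hXv 0 + u 0 * hlx
    · linear_combination μ * hux 1
    · linear_combination l * hXv 1 + u 1 * hlx
  · rw [eq_mul_inv_iff_mul_eq]
    apply Subtype.ext
    rw [Matrix.SpecialLinearGroup.coe_mul, Matrix.SpecialLinearGroup.coe_mul, hB, hQ]
    ext i j
    fin_cases i <;> fin_cases j <;>
      simp [Matrix.mul_apply, Fin.sum_univ_two]
    · linear_combination μ * hYu 0 + v 0 * hly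
    · linear_combination l * hvy 0
    · linear_combination μ * hYu 1 + v 1 * hly
    · linear_combination l * hvy 1

/-! ### The polygon -/

theorem lineSide_eq (a b z : ℂ) :
    lineSide a b z = (z.im - a.im) * (b.re - a.re) - (z.re - a.re) * (b.im - a.im) := by
  simp [lineSide, Complex.mul_im]; ring

theorem lineSide_conj (a b z : ℂ) : lineSide (conj a) (conj b) z = -lineSide a b (conj z) := by
  simp [lineSide_eq]; ring

theorem lineSide_reflection (p q : ℕ) (a b z : ℂ) :
    lineSide (reflection p q a) (reflection p q b) z = -lineSide a b (reflection p q z) := by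
  simp [lineSide_eq, reflection]; ring

/-- The numerator of x is |ρ*|². Hence x = |ρ*|²/Re ρ*, where the line through ρ* perpendicular to
the vector ρ* meets the real axis; so ρ* is the foot in `pingPong_of_foot`. -/
theorem normSq_rhoStar (p q : ℕ) : (rhoStar p q).re ^ 2 + (rhoStar p q).im ^ 2 =
    Real.cos (2 * Real.pi / p - 2 * Real.pi / q) - Real.cos (2 * Real.pi / p) -
      Real.cos (2 * Real.pi / q) +
      xi p * (Real.sin (Real.pi / p) - Real.sin (Real.pi / p - 2 * Real.pi / q)) + 5 := by
  have p1 := Real.sin_sq_add_cos_sq (Real.pi / p)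
  have p2 := Real.sin_sq_add_cos_sq (Real.pi / q)
  have hx2 := xi_sq p
  simp only [rhoStar, mul_div_assoc, Real.cos_sub, Real.sin_sub, Real.cos_two_mul, Real.sin_two_mul]
  grind

theorem re_rhoStar_gt {p q : ℕ} (hp : 3 ≤ p) (hq : 3 ≤ q) : axis p q < (rhoStar p q).re := by
  have hC := cos_pi_div_pos hp
  have hc := cos_pi_div_pos hq
  have hs := sin_pi_div_pos (n := q) (by omega)
  have := mul_pos hs (xi_pos p)
  have := mul_pos hC hc
  simp only [axis, rhoStar]
  linarith

theorem axis_pos {p q : ℕ} (hp : 2 ≤ p) (hq : 2 ≤ q) : 0 < axis p q := by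
  have := sin_pi_div_pos hp
  have := sin_pi_div_pos hq
  rw [axis]; positivity

theorem im_rhoStar_pos {p q : ℕ} (hp : 3 ≤ p) (hq : 3 ≤ q) : 0 < (rhoStar p q).im := by
  have hC := cos_pi_div_pos hp
  have hc := cos_pi_div_pos hq
  have hs := sin_pi_div_pos (n := q) (by omega)
  have := xi_pos p
  simp only [rhoStar]
  positivity

theorem axis_mul_re_lt {p q : ℕ} (hp : 3 ≤ p) (hq : 3 ≤ q) :
    axis p q * (rhoStar p q).re < (rhoStar p q).re ^ 2 + (rhoStar p q).im ^ 2 := by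
  have h1 := re_rhoStar_gt hp hq
  have h2 := axis_pos (p := p) (q := q) (by omega) (by omega)
  have h3 := mul_pos (sub_pos.mpr h1) (h2.trans h1)
  nlinarith [sq_nonneg (rhoStar p q).im]

/-- The line through `ρ*` and `x` is the line through `ρ*` orthogonal to the vector `ρ*`. -/
theorem lineSide_rhoStar {p q : ℕ} (hp : 3 ≤ p) (hq : 3 ≤ q) (z : ℂ) :
    lineSide (rhoStar p q) (xConst p q : ℂ) z = (rhoStar p q).im / (rhoStar p q).re *
      ((rhoStar p q).re * z.re + (rhoStar p q).im * z.im -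
        ((rhoStar p q).re ^ 2 + (rhoStar p q).im ^ 2)) := by
  have hre : 0 < (rhoStar p q).re :=
    (axis_pos (by omega) (by omega)).trans (re_rhoStar_gt hp hq)
  have hx : xConst p q =
      ((rhoStar p q).re ^ 2 + (rhoStar p q).im ^ 2) / (rhoStar p q).re := by
    rw [normSq_rhoStar]; rfl
  rw [lineSide_eq, Complex.ofReal_re, Complex.ofReal_im, hx]
  field_simp
  ring

theorem mul_pos_iff_neg_of_neg {x y : ℝ} (hy : y < 0) : 0 < x * y ↔ x < 0 :=
  ⟨fun h => by by_contra! hx; nlinarith, fun hx => mul_pos_of_neg_of_neg hx hy⟩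

theorem mul_neg_iff_neg_of_pos {x y : ℝ} (hy : 0 < y) : x * y < 0 ↔ x < 0 :=
  ⟨fun h => by by_contra! hx; nlinarith, fun hx => mul_neg_of_neg_of_pos hx hy⟩

theorem sameSide_rhoStar_iff {p q : ℕ} (hp : 3 ≤ p) (hq : 3 ≤ q) (z : ℂ) {m : ℝ}
    (hm : m = axis p q) :
    0 < lineSide (rhoStar p q) (xConst p q : ℂ) z * lineSide (rhoStar p q) (xConst p q : ℂ) m ↔
      (rhoStar p q).re * z.re + (rhoStar p q).im * z.im <
        (rhoStar p q).re ^ 2 + (rhoStar p q).im ^ 2 := by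
  have hre : 0 < (rhoStar p q).re :=
    (axis_pos (by omega) (by omega)).trans (re_rhoStar_gt hp hq)
  have him := im_rhoStar_pos hp hq
  have hax := axis_mul_re_lt hp hq
  have hneg : lineSide (rhoStar p q) (xConst p q : ℂ) m < 0 := by
    rw [lineSide_rhoStar hp hq, Complex.ofReal_re, Complex.ofReal_im, hm]
    exact mul_neg_of_pos_of_neg (by positivity) (by linarith)
  rw [mul_pos_iff_neg_of_neg hneg, lineSide_rhoStar hp hq, mul_comm,
    mul_neg_iff_neg_of_pos (by positivity), sub_neg]

theorem axis_comm (p q : ℕ) : axis p q = axis q p := by rw [axis, axis]; ring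

theorem reflection_axis (p q : ℕ) : reflection p q (axis p q : ℂ) = axis p q := by
  simp [reflection]; ring

theorem axis_lt {p q : ℕ} (hp : 3 ≤ p) (hq : 3 ≤ q) :
    2 * axis p q < 2 + 2 * Real.cos (Real.pi / p - Real.pi / q) := by
  have hC := cos_pi_div_pos hp
  have hc := cos_pi_div_pos hq
  have hS := sin_pi_div_pos (n := p) (by omega)
  have hs := sin_pi_div_pos (n := q) (by omega)
  have p1 := Real.sin_sq_add_cos_sq (Real.pi / p)
  have p2 := Real.sin_sq_add_cos_sq (Real.pi / q)
  rw [axis, Real.cos_sub]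
  nlinarith [mul_pos hC hc, sq_nonneg (Real.sin (Real.pi / p) - Real.sin (Real.pi / q)),
    sq_pos_of_pos hC, sq_pos_of_pos hc]

/-- Half the distance between the two horizontal lines. -/
def halfHeight (p q : ℕ) : ℝ := 2 * √(1 - Real.sin (Real.pi / p) ^ 2 * Real.sin (Real.pi / q) ^ 2)

theorem halfHeight_sq {p q : ℕ} : halfHeight p q ^ 2 = 4 - axis p q ^ 2 := by
  have h1 := Real.sin_sq_le_one (Real.pi / p)
  have h2 := Real.sin_sq_le_one (Real.pi / q)
  have h3 := mul_le_one₀ h1 (sq_nonneg _) h2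
  rw [halfHeight, axis, mul_pow, Real.sq_sqrt (by linarith)]
  ring

theorem axis_lt_two {p q : ℕ} (hp : 3 ≤ p) (hq : 3 ≤ q) : axis p q < 2 := by
  have := axis_lt hp hq
  linarith [Real.cos_le_one (Real.pi / p - Real.pi / q)]

theorem halfHeight_pos {p q : ℕ} (hp : 3 ≤ p) (hq : 3 ≤ q) : 0 < halfHeight p q := by
  have h0 : 0 ≤ halfHeight p q := by rw [halfHeight]; positivity
  have h1 := halfHeight_sq (p := p) (q := q)
  have h2 := axis_pos (p := p) (q := q) (by omega) (by omega)
  have h3 := axis_lt_two hp hq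
  apply lt_of_le_of_ne h0
  intro h
  rw [← h] at h1
  nlinarith

theorem sym_halfPlanes_iff {A B m x y r : ℝ} (hA : 0 < A) (hB : 0 < B) :
    (A * x + B * y < r ∧ A * x + B * -y < r ∧ A * (2 * m - x) + B * y < r ∧
      A * (2 * m - x) + B * -y < r) ↔ A * (m + |x - m|) + B * |y| < r := by
  rcases abs_cases (x - m) with ⟨h1, h1'⟩ | ⟨h1, h1'⟩ <;>
    rcases abs_cases y with ⟨h2, h2'⟩ | ⟨h2, h2'⟩ <;> rw [h1, h2]
  · have := mul_nonneg hA.le h1'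
    have := mul_nonneg hB.le h2'
    constructor
    · rintro ⟨a, b, c, d⟩; linarith
    · intro h; refine ⟨?_, ?_, ?_, ?_⟩ <;> linarith
  · have := mul_nonneg hA.le h1'
    have := mul_pos hB (neg_pos.mpr h2')
    constructor
    · rintro ⟨a, b, c, d⟩; linarith
    · intro h; refine ⟨?_, ?_, ?_, ?_⟩ <;> linarith
  · have := mul_pos hA (neg_pos.mpr h1')
    have := mul_nonneg hB.le h2'
    constructor
    · rintro ⟨a, b, c, d⟩; linarith
    · intro h; refine ⟨?_, ?_, ?_, ?_⟩ <;> linarith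
  · have := mul_pos hA (neg_pos.mpr h1')
    have := mul_pos hB (neg_pos.mpr h2')
    constructor
    · rintro ⟨a, b, c, d⟩; linarith
    · intro h; refine ⟨?_, ?_, ?_, ?_⟩ <;> linarith

/-- The polygon is symmetric under conjugation and reflection, so the twelve lines reduce to four
conditions on |Re z − m| and |Im z|. -/
theorem mem_Omega_iff {p q : ℕ} (hp : 3 ≤ p) (hq : 3 ≤ q) (z : ℂ) : z ∈ Omega p q ↔
    |z.re - axis p q| < 2 + 2 * Real.cos (Real.pi / p - Real.pi / q) - axis p q ∧
    |z.im| < halfHeight p q ∧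
    (rhoStar p q).re * (axis p q + |z.re - axis p q|) + (rhoStar p q).im * |z.im| <
      (rhoStar p q).re ^ 2 + (rhoStar p q).im ^ 2 ∧
    (rhoStar q p).re * (axis p q + |z.re - axis p q|) + (rhoStar q p).im * |z.im| <
      (rhoStar q p).re ^ 2 + (rhoStar q p).im ^ 2 := by
  have hm := axis_lt hp hq
  have hm0 := axis_pos (p := p) (q := q) (by omega) (by omega)
  have hh := halfHeight_pos hp hq
  have hpos : ∀ {p q : ℕ}, 3 ≤ p → 3 ≤ q → 0 < (rhoStar p q).re := fun hp hq =>
    (axis_pos (by omega) (by omega)).trans (re_rhoStar_gt hp hq)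
  have e1 : ∀ z : ℂ, 0 < lineSide ((2 + 2 * Real.cos (Real.pi / p - Real.pi / q) : ℝ) : ℂ)
      (((2 + 2 * Real.cos (Real.pi / p - Real.pi / q) : ℝ) : ℂ) + Complex.I) z *
      lineSide ((2 + 2 * Real.cos (Real.pi / p - Real.pi / q) : ℝ) : ℂ)
      (((2 + 2 * Real.cos (Real.pi / p - Real.pi / q) : ℝ) : ℂ) + Complex.I) (axis p q) ↔
      z.re < 2 + 2 * Real.cos (Real.pi / p - Real.pi / q) := by
    intro z
    generalize 2 + 2 * Real.cos (Real.pi / p - Real.pi / q) = c at *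
    have : lineSide (c : ℂ) (c + Complex.I) (axis p q) = c - axis p q := by
      simp [lineSide_eq]
    rw [this, mul_pos_iff_of_pos_right (by linarith)]
    simp [lineSide_eq]
  have e2 : ∀ z : ℂ, 0 < lineSide ((halfHeight p q : ℂ) * Complex.I)
      ((halfHeight p q : ℂ) * Complex.I + 1) z * lineSide ((halfHeight p q : ℂ) * Complex.I)
      ((halfHeight p q : ℂ) * Complex.I + 1) (axis p q) ↔ z.im < halfHeight p q := by
    intro z
    have : lineSide ((halfHeight p q : ℂ) * Complex.I)
      ((halfHeight p q : ℂ) * Complex.I + 1) (axis p q) < 0 := by simp [lineSide_eq, hh]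
    rw [mul_pos_iff_neg_of_neg this]
    simp [lineSide_eq]
  have cm : conj (axis p q : ℂ) = axis p q := Complex.conj_ofReal _
  have hneg : -((halfHeight p q : ℂ) * Complex.I) = conj ((halfHeight p q : ℂ) * Complex.I) := by
    simp
  have hneg1 : conj ((halfHeight p q : ℂ) * Complex.I) + 1 =
      conj ((halfHeight p q : ℂ) * Complex.I + 1) := by simp
  have hdef : ((2 * √(1 - Real.sin (Real.pi / p) ^ 2 * Real.sin (Real.pi / q) ^ 2) : ℝ) : ℂ) =
    (halfHeight p q : ℂ) := rfl
  have hr1 : ∀ z, (reflection p q z).re = 2 * axis p q - z.re := by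
    intro z; simp [reflection]
  have hr2 : ∀ z, (reflection p q z).im = z.im := by intro z; simp [reflection]
  rw [Omega, Set.mem_ofPred_eq]
  simp only [boundaryLines, Set.mem_insert_iff, Set.mem_singleton_iff, forall_eq_or_imp, forall_eq,
    hdef, hneg, hneg1]
  simp only [lineSide_reflection, lineSide_conj, reflection_axis, cm, neg_mul_neg, e1, e2,
    sameSide_rhoStar_iff hp hq _ rfl, sameSide_rhoStar_iff hq hp _ (axis_comm p q), hr1, hr2,
    Complex.conj_re, Complex.conj_im]
  rw [← sym_halfPlanes_iff (hpos hp hq) (im_rhoStar_pos hp hq),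
    ← sym_halfPlanes_iff (hpos hq hp) (im_rhoStar_pos hq hp), abs_lt, abs_lt]
  constructor
  · rintro ⟨a1, a2, a3, a4, a5, a6, a7, a8, a9, a10, a11, a12⟩
    exact ⟨⟨by linarith, by linarith⟩, ⟨by linarith, a3⟩, ⟨a5, a6, a7, a8⟩, a9, a10, a11, a12⟩
  · rintro ⟨⟨a1, a2⟩, ⟨a3, a4⟩, ⟨a5, a6, a7, a8⟩, a9, a10, a11, a12⟩
    exact ⟨by linarith, by linarith, a4, by linarith, a5, a6, a7, a8, a9, a10, a11, a12⟩

/-! ### Part (a): from traces to ping-pong -/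

theorem expPi_add_inv (n : ℕ) :
    expPi n + (expPi n)⁻¹ = ((2 * Real.cos (Real.pi / n) : ℝ) : ℂ) := by
  rw [expPi_inv_eq, expPi_eq]
  simp only [Complex.ofReal_mul, Complex.ofReal_ofNat]
  ring

theorem pingPong_of_trace {p q : ℕ} {X Y : SL(2, ℂ)} {w : ℂ}
    (hX : X.val.trace = ((2 * Real.cos (Real.pi / p) : ℝ) : ℂ))
    (hY : Y.val.trace = ((2 * Real.cos (Real.pi / q) : ℝ) : ℂ))
    (hXY : (X * Y).val.trace = w + ((2 * Real.cos (Real.pi / p + Real.pi / q) : ℝ) : ℂ))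
    (hw0 : w ≠ 0) (hw1 : w ≠ ((2 * axis p q : ℝ) : ℂ))
    (h : PingPong (matA p) (matB q w)) : PingPong X Y := by
  have e1 : ((2 * Real.cos (Real.pi / p + Real.pi / q) : ℝ) : ℂ) =
      expPi p * expPi q + (expPi p)⁻¹ * (expPi q)⁻¹ := by
    rw [expPi_inv_eq, expPi_inv_eq, expPi_eq, expPi_eq, Real.cos_add]
    simp only [Complex.ofReal_mul, Complex.ofReal_ofNat, Complex.ofReal_sub]
    linear_combination (-2 * Real.sin (Real.pi / p) * Real.sin (Real.pi / q) : ℂ) * Complex.I_sq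
  have e2 : ((2 * axis p q : ℝ) : ℂ) + (expPi p * expPi q + (expPi p)⁻¹ * (expPi q)⁻¹) =
      expPi p * (expPi q)⁻¹ + (expPi p)⁻¹ * expPi q := by
    rw [expPi_inv_eq, expPi_inv_eq, expPi_eq, expPi_eq, axis]
    simp only [Complex.ofReal_mul, Complex.ofReal_ofNat]
    linear_combination (4 * Real.sin (Real.pi / p) * Real.sin (Real.pi / q) : ℂ) * Complex.I_sq
  rw [e1] at hXY
  obtain ⟨P, rfl, rfl⟩ := exists_conj_matA_matB (p := p) (q := q) (r := w)
    (by rw [hX, expPi_add_inv]) (by rw [hY, expPi_add_inv]) (by rw [hXY]; ring) hw0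
    (by
      rw [hXY, ← e2]
      intro h'
      exact hw1 (add_right_cancel h'))
  exact h.conj P

theorem isDiscreteGroup_and_isFreeProduct_of_trace {p q : ℕ} (hp : 3 ≤ p) (hq : 3 ≤ q)
    {X Y : SL(2, ℂ)} {w : ℂ}
    (hX : X.val.trace = ((2 * Real.cos (Real.pi / p) : ℝ) : ℂ))
    (hY : Y.val.trace = ((2 * Real.cos (Real.pi / q) : ℝ) : ℂ))
    (hXY : (X * Y).val.trace = w + ((2 * Real.cos (Real.pi / p + Real.pi / q) : ℝ) : ℂ))
    (hw0 : w ≠ 0) (hw1 : w ≠ ((2 * axis p q : ℝ) : ℂ))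
    (h : 2 + 2 * Real.cos (Real.pi / p - Real.pi / q) ≤ w.re ∨ halfHeight p q ≤ w.im ∨
      (rhoStar p q).re ^ 2 + (rhoStar p q).im ^ 2 ≤
        (rhoStar p q).re * w.re + (rhoStar p q).im * |w.im| ∨
      (rhoStar q p).re ^ 2 + (rhoStar q p).im ^ 2 ≤
        (rhoStar q p).re * w.re + (rhoStar q p).im * |w.im|) :
    IsDiscreteGroup X Y ∧ IsFreeProduct X Y := by
  have habs : ∀ m : ℝ, ∃ y, (y = m ∨ y = -m) ∧ m * |w.im| = w.im * y ∧ m ^ 2 = y ^ 2 := by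
    intro m
    rcases abs_choice w.im with h | h
    · exact ⟨m, Or.inl rfl, by rw [h]; ring, rfl⟩
    · exact ⟨-m, Or.inr rfl, by rw [h]; ring, by ring⟩
  rcases h with h | h | h | h
  · exact (pingPong_of_trace hX hY hXY hw0 hw1
      (pingPong_of_le_re hp hq h)).isDiscreteGroup_and_isFreeProduct
  · exact (pingPong_of_trace hX hY hXY hw0 hw1
      (pingPong_of_le_im hp hq h)).isDiscreteGroup_and_isFreeProduct
  · obtain ⟨y, hy, hy1, hy2⟩ := habs (rhoStar p q).im
    -- The half-plane of ρ*_{p,q} comes from discs for which the generator of order q plays the role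
    -- of A; tr XY = tr YX keeps w unchanged.
    apply isDiscreteGroup_and_isFreeProduct_comm
    refine (pingPong_of_trace (w := w) hY hX ?_ hw0 (by rwa [axis_comm])
      (pingPong_of_rhoStar hq hp hy (by linarith))).isDiscreteGroup_and_isFreeProduct
    rw [Matrix.SpecialLinearGroup.coe_mul, Matrix.trace_mul_comm, add_comm (Real.pi / q), ← hXY]
    rfl
  · obtain ⟨y, hy, hy1, hy2⟩ := habs (rhoStar q p).im
    exact (pingPong_of_trace hX hY hXY hw0 hw1
      (pingPong_of_rhoStar hp hq hy (by linarith))).isDiscreteGroup_and_isFreeProduct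

/-- As ρ* lies on the circle of radius 2 about 2k, with k the cosine, the difference of the two
sides is 2(1 − k)(2 + 2k − Re ρ*), and both factors are nonnegative. It puts the real cusps on the
inner side of the slanted lines. -/
theorem re_rhoStar_le {p q : ℕ} :
    (2 + 2 * Real.cos (Real.pi / p - Real.pi / q)) * (rhoStar p q).re ≤
      (rhoStar p q).re ^ 2 + (rhoStar p q).im ^ 2 := by
  have p1 := Real.sin_sq_add_cos_sq (Real.pi / p)
  have p2 := Real.sin_sq_add_cos_sq (Real.pi / q)
  have hx2 := xi_sq p
  have key : ((rhoStar p q).re - 2 * Real.cos (Real.pi / p - Real.pi / q)) ^ 2 +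
      (rhoStar p q).im ^ 2 = 4 := by
    simp only [rhoStar, Real.cos_sub]
    linear_combination (xi p ^ 2 / 4 + Real.cos (Real.pi / p) ^ 2) * p2 + 1 / 4 * hx2 + p1
  have h1 := Real.cos_le_one (Real.pi / p - Real.pi / q)
  generalize Real.cos (Real.pi / p - Real.pi / q) = k at *
  have h2 : (rhoStar p q).re - 2 * k ≤ 2 := by
    nlinarith [sq_nonneg (rhoStar p q).im]
  nlinarith [mul_nonneg (sub_nonneg.mpr h1) (sub_nonneg.mpr h2)]

theorem four_le_normSq_rhoStar {p q : ℕ} (hp : 3 ≤ p) (hq : 3 ≤ q) :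
    4 ≤ (rhoStar p q).re ^ 2 + (rhoStar p q).im ^ 2 := by
  have hC := cos_pi_div_pos hp
  have hc := cos_pi_div_pos hq
  have hS := sin_pi_div_pos (n := p) (by omega)
  have hs := sin_pi_div_pos (n := q) (by omega)
  have p1 := Real.sin_sq_add_cos_sq (Real.pi / p)
  have p2 := Real.sin_sq_add_cos_sq (Real.pi / q)
  have hx2 := xi_sq p
  have hx := xi_pos p
  have : (rhoStar p q).re ^ 2 + (rhoStar p q).im ^ 2 = 4 +
      (4 * Real.sin (Real.pi / p) * Real.cos (Real.pi / q) * Real.sin (Real.pi / q) *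
        Real.cos (Real.pi / p) + 2 * Real.cos (Real.pi / p) * Real.cos (Real.pi / q) *
        Real.sin (Real.pi / q) * xi p + 4 * Real.sin (Real.pi / p) ^ 2 *
        Real.sin (Real.pi / q) ^ 2 + 2 * Real.sin (Real.pi / p) * xi p *
        Real.sin (Real.pi / q) ^ 2) := by
    simp only [rhoStar]
    linear_combination (xi p ^ 2 / 4 + Real.cos (Real.pi / p) ^ 2) * p2 + 1 / 4 * hx2 + p1
  rw [this]
  have : 0 ≤ 4 * Real.sin (Real.pi / p) * Real.cos (Real.pi / q) * Real.sin (Real.pi / q) *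
        Real.cos (Real.pi / p) + 2 * Real.cos (Real.pi / p) * Real.cos (Real.pi / q) *
        Real.sin (Real.pi / q) * xi p + 4 * Real.sin (Real.pi / p) ^ 2 *
        Real.sin (Real.pi / q) ^ 2 + 2 * Real.sin (Real.pi / p) * xi p *
        Real.sin (Real.pi / q) ^ 2 := by positivity
  linarith

/-- The points in question are 0 and 2m, the parameters with tr[X,Y] = 2, for which the normal form
is not available. -/
theorem mem_Omega_of_re_eq {p q : ℕ} (hp : 3 ≤ p) (hq : 3 ≤ q) {z : ℂ}
    (h1 : |z.re - axis p q| = axis p q) (h2 : z.im = 0) : z ∈ Omega p q := by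
  have key : ∀ {p q : ℕ}, 3 ≤ p → 3 ≤ q → (rhoStar p q).re * (axis p q + axis p q) <
      (rhoStar p q).re ^ 2 + (rhoStar p q).im ^ 2 := by
    intro p q hp hq
    have hre : 0 < (rhoStar p q).re :=
      (axis_pos (by omega) (by omega)).trans (re_rhoStar_gt hp hq)
    have := mul_lt_mul_of_pos_right (axis_lt hp hq) hre
    have := re_rhoStar_le (p := p) (q := q)
    linarith
  have h := axis_lt hp hq
  rw [mem_Omega_iff hp hq, h1, h2, abs_zero, mul_zero, mul_zero, add_zero, add_zero]
  refine ⟨by linarith, halfHeight_pos hp hq, key hp hq, ?_⟩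
  rw [axis_comm]
  exact key hq hp

theorem isDiscreteGroup_and_isFreeProduct_of_inv {X Y : SL(2, ℂ)}
    (h : IsDiscreteGroup X Y⁻¹ ∧ IsFreeProduct X Y⁻¹) : IsDiscreteGroup X Y ∧ IsFreeProduct X Y := by
  have hg : generatedGroup X Y⁻¹ = generatedGroup X Y := by
    rw [← range_freeProductHom, ← range_freeProductHom, freeProductHom, freeProductHom,
      Monoid.Coprod.range_lift, Monoid.Coprod.range_lift, Subgroup.range_subtype,
      Subgroup.range_subtype, Subgroup.range_subtype, toPSL_inv, Subgroup.zpowers_inv]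
  unfold IsDiscreteGroup IsFreeProduct at h ⊢
  rwa [hg, toPSL_inv, Subgroup.zpowers_inv] at h

/-- The commutator trace leaves two values for the parameter read off from tr XY, namely ρ and 2m −
ρ, and replacing Y by Y⁻¹ interchanges them. So either of the two may be tested against the
half-planes. -/
theorem isDiscreteGroup_and_isFreeProduct_of_notMem_Omega {p q : ℕ} (hp : 3 ≤ p) (hq : 3 ≤ q)
    {X Y : SL(2, ℂ)} {ρ : ℂ}
    (hX : X.val.trace = ((2 * Real.cos (Real.pi / p) : ℝ) : ℂ))
    (hY : Y.val.trace = ((2 * Real.cos (Real.pi / q) : ℝ) : ℂ))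
    (hρ : ρ * (ρ - ((2 * axis p q : ℝ) : ℂ)) = (X * Y * X⁻¹ * Y⁻¹).val.trace - 2)
    (hΩ : ρ ∉ Omega p q) : IsDiscreteGroup X Y ∧ IsFreeProduct X Y := by
  have ha := axis_pos (p := p) (q := q) (by omega) (by omega)
  have hρ0 : ρ ≠ 0 := by
    rintro rfl
    exact hΩ (mem_Omega_of_re_eq hp hq (by simp [abs_of_pos ha]) rfl)
  have hρ1 : ρ ≠ ((2 * axis p q : ℝ) : ℂ) := by
    rintro rfl
    refine hΩ (mem_Omega_of_re_eq hp hq ?_ (Complex.ofReal_im _))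
    rw [Complex.ofReal_re, two_mul, add_sub_cancel_right, abs_of_pos ha]
  obtain ⟨r, hr⟩ : ∃ r, r = (X * Y).val.trace -
    ((2 * Real.cos (Real.pi / p + Real.pi / q) : ℝ) : ℂ) := ⟨_, rfl⟩
  have hr' : r = ρ ∨ r = ((2 * axis p q : ℝ) : ℂ) - ρ := by
    have h1 : (r - ρ) * (r - (((2 * axis p q : ℝ) : ℂ) - ρ)) = 0 := by
      have p1 := Complex.sin_sq_add_cos_sq (Real.pi / p)
      have p2 := Complex.sin_sq_add_cos_sq (Real.pi / q)
      rw [trace_commutator, hX, hY] at hρ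
      rw [hr]
      generalize (X * Y).val.trace = z at *
      simp only [axis, Real.cos_add] at *
      push_cast at *
      grind
    rcases mul_eq_zero.mp h1 with h | h
    · exact Or.inl (sub_eq_zero.mp h)
    · exact Or.inr (sub_eq_zero.mp h)
  have key : ∀ w : ℂ, (w = ρ ∨ w = ((2 * axis p q : ℝ) : ℂ) - ρ) →
      (2 + 2 * Real.cos (Real.pi / p - Real.pi / q) ≤ w.re ∨ halfHeight p q ≤ w.im ∨
      (rhoStar p q).re ^ 2 + (rhoStar p q).im ^ 2 ≤
        (rhoStar p q).re * w.re + (rhoStar p q).im * |w.im| ∨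
      (rhoStar q p).re ^ 2 + (rhoStar q p).im ^ 2 ≤
        (rhoStar q p).re * w.re + (rhoStar q p).im * |w.im|) →
      IsDiscreteGroup X Y ∧ IsFreeProduct X Y := by
    intro w hw h
    have hw0 : w ≠ 0 := by
      rcases hw with rfl | rfl
      · exact hρ0
      · exact sub_ne_zero.mpr hρ1.symm
    have hw1 : w ≠ ((2 * axis p q : ℝ) : ℂ) := by
      rcases hw with rfl | rfl
      · exact hρ1
      · intro h; exact hρ0 (by linear_combination -h)
    have hwr : w = r ∨ w = ((2 * axis p q : ℝ) : ℂ) - r := by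
      rcases hw with rfl | rfl <;> rcases hr' with h | h <;> rw [h]
      · exact Or.inl rfl
      · right; ring
      · right; ring
      · exact Or.inl rfl
    rcases hwr with hwr | hwr
    · exact isDiscreteGroup_and_isFreeProduct_of_trace hp hq hX hY (by rw [hwr, hr]; ring) hw0 hw1 h
    · apply isDiscreteGroup_and_isFreeProduct_of_inv
      refine isDiscreteGroup_and_isFreeProduct_of_trace hp hq hX (by rw [trace_inv, hY]) ?_ hw0 hw1 h
      rw [trace_mul_inv, hX, hY, hwr, hr]
      simp only [axis, Real.cos_add]
      push_cast
      ring
  -- The exchange ρ ↔ 2m − ρ is the half-turn about m. One of the two points is on or to the right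
  -- of the axis, which serves the vertical and slanted lines; one has Im ≥ 0, which serves the
  -- horizontal line.
  have hre : ∃ w, (w = ρ ∨ w = ((2 * axis p q : ℝ) : ℂ) - ρ) ∧
      w.re = axis p q + |ρ.re - axis p q| ∧ |w.im| = |ρ.im| := by
    rcases abs_choice (ρ.re - axis p q) with h | h
    · exact ⟨_, Or.inl rfl, by rw [h]; ring, rfl⟩
    · refine ⟨_, Or.inr rfl, ?_, ?_⟩
      · rw [h, Complex.sub_re, Complex.ofReal_re]; ring
      · rw [Complex.sub_im, Complex.ofReal_im, zero_sub, abs_neg]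
  have him : ∃ w, (w = ρ ∨ w = ((2 * axis p q : ℝ) : ℂ) - ρ) ∧ w.im = |ρ.im| := by
    rcases abs_choice ρ.im with h | h
    · exact ⟨_, Or.inl rfl, h.symm⟩
    · exact ⟨_, Or.inr rfl, by rw [h, Complex.sub_im, Complex.ofReal_im, zero_sub]⟩
  obtain ⟨w, hw, hwr, hwi⟩ := hre
  obtain ⟨w', hw', hwi'⟩ := him
  rw [mem_Omega_iff hp hq, ← hwr, ← hwi, not_and_or, not_and_or, not_and_or, not_lt, not_lt, not_lt,
    not_lt, hwi, ← hwi', ← abs_of_nonneg (hwi' ▸ abs_nonneg _ : 0 ≤ w'.im), hwi', abs_abs,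
    ← hwi] at hΩ
  rcases hΩ with h | h | h | h
  · exact key w hw (Or.inl (by linarith))
  · exact key w' hw' (Or.inr (Or.inl (by rwa [hwi', ← hwi])))
  · exact key w hw (Or.inr (Or.inr (Or.inl h)))
  · exact key w hw (Or.inr (Or.inr (Or.inr h)))

theorem exists_trace_eq {n : ℕ} {X : SL(2, ℂ)} (h : IsPrimitiveElliptic n X) :
    ∃ X' : SL(2, ℂ), (X' = X ∨ X' = -X) ∧
      X'.val.trace = ((2 * Real.cos (Real.pi / n) : ℝ) : ℂ) := by
  rcases h with h | h
  · exact ⟨X, Or.inl rfl, h⟩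
  · refine ⟨-X, Or.inr rfl, ?_⟩
    rw [Matrix.SpecialLinearGroup.coe_neg, Matrix.trace_neg, h]
    push_cast
    ring

theorem isDiscreteGroup_and_isFreeProduct_of_isPrimitiveElliptic {p q : ℕ} (hp : 3 ≤ p)
    (hq : 3 ≤ q) {X Y : SL(2, ℂ)} {ρ : ℂ} (hX : IsPrimitiveElliptic p X)
    (hY : IsPrimitiveElliptic q Y)
    (hρ : ρ * (ρ - ((4 * Real.sin (Real.pi / p) * Real.sin (Real.pi / q) : ℝ) : ℂ)) =
      (X * Y * X⁻¹ * Y⁻¹).val.trace - 2)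
    (hΩ : ρ ∉ Omega p q) : IsDiscreteGroup X Y ∧ IsFreeProduct X Y := by
  obtain ⟨X', hX', tX⟩ := exists_trace_eq hX
  obtain ⟨Y', hY', tY⟩ := exists_trace_eq hY
  have eX : toPSL X' = toPSL X := toPSL_eq_iff.mpr hX'
  have eY : toPSL Y' = toPSL Y := toPSL_eq_iff.mpr hY'
  refine isDiscreteGroup_and_isFreeProduct_congr eX eY
    (isDiscreteGroup_and_isFreeProduct_of_notMem_Omega hp hq tX tY (ρ := ρ) ?_ hΩ)
  have e1 : 2 * axis p q = 4 * Real.sin (Real.pi / p) * Real.sin (Real.pi / q) := by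
    rw [axis]; ring
  have e2 : X' * Y' * X'⁻¹ * Y'⁻¹ = X * Y * X⁻¹ * Y⁻¹ := by
    rcases hX' with rfl | rfl <;> rcases hY' with rfl | rfl <;> simp
  rw [e1, e2, hρ]

/-! ### Powers of matrices of trace `±2 cos (π / n)` and `±2` -/

theorem sq_eq_trace_smul_sub_one (X : SL(2, ℂ)) :
    X.val * X.val = X.val.trace • X.val - 1 := by
  have h := X.det_coe
  rw [Matrix.det_fin_two] at h
  ext i j
  fin_cases i <;> fin_cases j <;>
    simp [Matrix.mul_apply, Fin.sum_univ_two, Matrix.trace_fin_two] <;> grind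

/-- The Chebyshev recursion writes sin(π/n)(−X)^(k+1) in terms of −X and 1; at k + 1 = n it gives
(−X)ⁿ = −1. -/
theorem toPSL_pow_eq_one_of_trace {n : ℕ} (hn : 2 ≤ n) {X : SL(2, ℂ)}
    (h : X.val.trace = ((-(2 * Real.cos (Real.pi / n)) : ℝ) : ℂ)) : toPSL X ^ n = 1 := by
  have key : ∀ k : ℕ, ((Real.sin (Real.pi / n) : ℝ) : ℂ) • ((-X) ^ (k + 1)).val =
      ((Real.sin ((k + 1) * (Real.pi / n)) : ℝ) : ℂ) • (-X).val -
        ((Real.sin (k * (Real.pi / n)) : ℝ) : ℂ) • (1 : Matrix (Fin 2) (Fin 2) ℂ) := by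
    intro k
    induction k with
    | zero => simp
    | succ k ih =>
      have h2 := sq_eq_trace_smul_sub_one (-X)
      rw [Matrix.SpecialLinearGroup.coe_neg, Matrix.trace_neg, h] at h2
      rw [pow_succ, Matrix.SpecialLinearGroup.coe_mul, ← smul_mul_assoc, ih, sub_mul,
        smul_mul_assoc, Matrix.SpecialLinearGroup.coe_neg, h2, smul_mul_assoc, one_mul]
      have : Real.sin (((k + 1 : ℕ) + 1) * (Real.pi / n)) =
          2 * Real.cos (Real.pi / n) * Real.sin ((k + 1) * (Real.pi / n)) -
            Real.sin (k * (Real.pi / n)) := by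
        have e1 : (((k + 1 : ℕ) : ℝ) + 1) * (Real.pi / n) =
          (k + 1) * (Real.pi / n) + Real.pi / n := by push_cast; ring
        have e2 : (k : ℝ) * (Real.pi / n) = (k + 1) * (Real.pi / n) - Real.pi / n := by ring
        rw [e1, e2, Real.sin_add, Real.sin_sub]
        ring
      rw [this]
      push_cast
      module
  have hs : ((Real.sin (Real.pi / n) : ℝ) : ℂ) ≠ 0 :=
    Complex.ofReal_ne_zero.mpr (sin_pi_div_pos hn).ne'
  obtain ⟨k, rfl⟩ : ∃ k, n = k + 1 := ⟨n - 1, by omega⟩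
  have h1 := key k
  have hk : ((k : ℝ) + 1) * (Real.pi / (k + 1 : ℕ)) = Real.pi := by
    push_cast
    field_simp
  have e2 : (k : ℝ) * (Real.pi / (k + 1 : ℕ)) = Real.pi - Real.pi / (k + 1 : ℕ) := by
    linear_combination hk
  rw [hk, e2, Real.sin_pi, Real.sin_pi_sub, Complex.ofReal_zero, zero_smul, zero_sub,
    ← smul_neg] at h1
  have h3 := smul_right_injective _ hs h1
  rw [← toPSL_neg, ← toPSL_pow, toPSL_eq_one_iff]
  right
  ext1
  rw [h3]
  simp

/-- The matrix −X is unipotent and its upper right entry is nonzero, so that entry grows linearly in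
the powers. -/
theorem eq_zero_of_toPSL_pow_eq_one {n : ℕ} {X : SL(2, ℂ)} (h : X.val.trace = -2)
    (h1 : X.val 0 1 ≠ 0) (hn : toPSL X ^ n = 1) : n = 0 := by
  have key : ∀ k : ℕ, ((-X) ^ k).val = (k : ℂ) • (-X).val -
      ((k : ℂ) - 1) • (1 : Matrix (Fin 2) (Fin 2) ℂ) := by
    intro k
    induction k with
    | zero => simp
    | succ k ih =>
      have h2 := sq_eq_trace_smul_sub_one (-X)
      rw [Matrix.SpecialLinearGroup.coe_neg, Matrix.trace_neg, h] at h2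
      rw [pow_succ, Matrix.SpecialLinearGroup.coe_mul, ih, sub_mul,
        smul_mul_assoc, Matrix.SpecialLinearGroup.coe_neg, h2, smul_mul_assoc, one_mul]
      push_cast
      module
  have h2 : ((-X) ^ n).val 0 1 = 0 := by
    rw [← toPSL_neg, ← toPSL_pow, toPSL_eq_one_iff] at hn
    rcases hn with h | h <;> rw [h] <;> simp
  rw [key] at h2
  simpa [h1] using h2

theorem isParabolic_of_trace {X : SL(2, ℂ)} (h : X.val.trace = -2) (h1 : X.val 0 1 ≠ 0) :
    X.val.IsParabolic := by
  refine ⟨?_, ?_⟩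
  · rintro ⟨r, hr⟩
    rw [← hr] at h1
    simp at h1
  · rw [Matrix.discr_fin_two, h, X.det_coe]
    norm_num

/-! ### Relations in a free product are relations in its deformations -/

theorem exists_monoidHom_zpowers {X X' : SL(2, ℂ)}
    (h : ∀ k : ℤ, toPSL (X ^ k) = 1 → toPSL (X' ^ k) = 1) :
    ∃ f : Subgroup.zpowers (toPSL X) →* PSL(2, ℂ),
      f ⟨toPSL X, Subgroup.mem_zpowers _⟩ = toPSL X' := by
  have hg : ∀ x : Subgroup.zpowers (toPSL X),
      x ∈ Subgroup.zpowers (⟨toPSL X, Subgroup.mem_zpowers _⟩ : Subgroup.zpowers (toPSL X)) := by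
    rintro ⟨x, k, rfl⟩
    exact ⟨k, rfl⟩
  refine ⟨monoidHomOfForallMemZpowers hg (g' := toPSL X') ?_, monoidHomOfForallMemZpowers_apply_gen _ _⟩
  rw [orderOf_dvd_iff_pow_eq_one]
  have := h (orderOf (toPSL X)) (by rw [toPSL_zpow, zpow_natCast, pow_orderOf_eq_one])
  rwa [toPSL_zpow, zpow_natCast, ← Subgroup.orderOf_mk _ (Subgroup.mem_zpowers (toPSL X))] at this

/-- A relation in a free product of cyclic groups follows from the orders of the generators, so it
holds for any pair whose generators satisfy those orders. -/
theorem IsFreeProduct.lift_eq_one {X Y X' Y' : SL(2, ℂ)} (h : IsFreeProduct X Y)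
    (hX : ∀ k : ℤ, toPSL (X ^ k) = 1 → toPSL (X' ^ k) = 1)
    (hY : ∀ k : ℤ, toPSL (Y ^ k) = 1 → toPSL (Y' ^ k) = 1) {w : FreeGroup (Fin 2)}
    (hw : FreeGroup.lift ![toPSL X, toPSL Y] w = 1) :
    FreeGroup.lift ![toPSL X', toPSL Y'] w = 1 := by
  obtain ⟨φ, h1, h2⟩ := h
  obtain ⟨f, hf⟩ := exists_monoidHom_zpowers hX
  obtain ⟨g, hg⟩ := exists_monoidHom_zpowers hY
  let L : FreeGroup (Fin 2) →* Monoid.Coprod (Subgroup.zpowers (toPSL X))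
      (Subgroup.zpowers (toPSL Y)) :=
    FreeGroup.lift ![Monoid.Coprod.inl ⟨toPSL X, Subgroup.mem_zpowers _⟩,
      Monoid.Coprod.inr ⟨toPSL Y, Subgroup.mem_zpowers _⟩]
  have e1 : ((generatedGroup X Y).subtype.comp φ.toMonoidHom).comp L =
      FreeGroup.lift ![toPSL X, toPSL Y] := by
    ext i
    fin_cases i
    · simp [L, h1]
    · simp [L, h2]
  have e2 : (Monoid.Coprod.lift f g).comp L = FreeGroup.lift ![toPSL X', toPSL Y'] := by
    ext i
    fin_cases i
    · simp [L, hf]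
    · simp [L, hg]
  have h3 : L w = 1 := by
    rw [← e1] at hw
    have : φ (L w) = 1 := Subtype.ext hw
    simpa using this
  rw [← e2, MonoidHom.comp_apply, h3, map_one]

/-! ### Cusp groups -/

theorem lift_mem_generatedGroup (X Y : SL(2, ℂ)) (w : FreeGroup (Fin 2)) :
    FreeGroup.lift ![toPSL X, toPSL Y] w ∈ generatedGroup X Y := by
  refine FreeGroup.range_lift_le (s := generatedGroup X Y) ?_ ⟨w, rfl⟩
  rintro _ ⟨i, rfl⟩
  fin_cases i
  · exact Subgroup.subset_closure (Or.inl rfl)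
  · exact Subgroup.subset_closure (Or.inr rfl)

-- At r n the word is elliptic with n-th power 1. If ρ were interior, some r n would give a free
-- product, and the relation would transfer to ρ, where the word is parabolic.
open Filter Topology in
theorem isCuspGroup_of_word {p q : ℕ} (hq : 2 ≤ q) {ρ : ℂ}
    (hρ : ρ ∈ closedDeformationSpace p q) (w : FreeGroup (Fin 2)) (W : ℂ → SL(2, ℂ))
    (hW : ∀ r, FreeGroup.lift ![toPSL (matA p), toPSL (matB q r)] w = toPSL (W r))
    (htr : (W ρ).val.trace = -2) (h01 : (W ρ).val 0 1 ≠ 0) (r : ℕ → ℂ)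
    (hr : Tendsto r atTop (𝓝 ρ))
    (hrW : ∀ᶠ n : ℕ in atTop, (W (r n)).val.trace = ((-(2 * Real.cos (Real.pi / n)) : ℝ) : ℂ)) :
    IsCuspGroup p q ρ := by
  refine ⟨hρ, ⟨subset_closure hρ, fun hint => ?_⟩, W ρ, ?_, isParabolic_of_trace htr h01⟩
  · obtain ⟨n, h1, h2, hn⟩ :=
      ((hr.eventually (mem_interior_iff_mem_nhds.mp hint)).and
        (hrW.and (eventually_ge_atTop 2))).exists
    have h3 : FreeGroup.lift ![toPSL (matA p), toPSL (matB q (r n))] (w ^ n) = 1 := by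
      rw [map_pow, hW, toPSL_pow_eq_one_of_trace hn h2]
    have h4 := IsFreeProduct.lift_eq_one (X' := matA p) (Y' := matB q ρ) h1.2 (fun k => id)
      (fun k hk => by rwa [toPSL_matB_zpow hq] at hk ⊢) h3
    rw [map_pow, hW] at h4
    have := eq_zero_of_toPSL_pow_eq_one htr h01 h4
    omega
  · rw [← hW]
    exact lift_mem_generatedGroup _ _ _

theorem trace_matA (p : ℕ) : (matA p).val.trace = ((2 * Real.cos (Real.pi / p) : ℝ) : ℂ) := by
  rw [Matrix.trace_fin_two]
  exact expPi_add_inv p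

theorem trace_matB (q : ℕ) (ρ : ℂ) :
    (matB q ρ).val.trace = ((2 * Real.cos (Real.pi / q) : ℝ) : ℂ) := by
  rw [Matrix.trace_fin_two]
  exact expPi_add_inv q

theorem trace_matA_mul_matB (p q : ℕ) (ρ : ℂ) : (matA p * matB q ρ).val.trace =
    ρ + ((2 * Real.cos (Real.pi / p + Real.pi / q) : ℝ) : ℂ) := by
  have : (matA p * matB q ρ).val.trace =
      ρ + (expPi p * expPi q + (expPi p)⁻¹ * (expPi q)⁻¹) := by
    rw [Matrix.SpecialLinearGroup.coe_mul, Matrix.trace_fin_two]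
    simp [matA, matB, Matrix.mul_apply, Fin.sum_univ_two, expPi]
    ring
  rw [this, expPi_inv_eq, expPi_inv_eq, expPi_eq, expPi_eq, Real.cos_add]
  push_cast
  linear_combination 2 * Complex.sin (Real.pi / p) * Complex.sin (Real.pi / q) * Complex.I_sq

theorem trace_matA_mul_matB_inv (p q : ℕ) (ρ : ℂ) : (matA p * (matB q ρ)⁻¹).val.trace =
    ((2 * Real.cos (Real.pi / p - Real.pi / q) : ℝ) : ℂ) - ρ := by
  rw [trace_mul_inv, trace_matA_mul_matB, trace_matA, trace_matB, Real.cos_add, Real.cos_sub]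
  push_cast
  ring

theorem trace_commutator_matA_matB (p q : ℕ) (ρ : ℂ) :
    (matA p * matB q ρ * (matA p)⁻¹ * (matB q ρ)⁻¹).val.trace =
      2 + ρ * (ρ - ((2 * axis p q : ℝ) : ℂ)) := by
  have p1 := Complex.sin_sq_add_cos_sq (Real.pi / p)
  have p2 := Complex.sin_sq_add_cos_sq (Real.pi / q)
  rw [trace_commutator, trace_matA_mul_matB, trace_matA, trace_matB, Real.cos_add, axis]
  push_cast
  grind

theorem mem_closedDeformationSpace {p q : ℕ} (hp : 3 ≤ p) (hq : 3 ≤ q) {ρ : ℂ}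
    (h : ρ ∉ Omega p q) : ρ ∈ closedDeformationSpace p q := by
  refine isDiscreteGroup_and_isFreeProduct_of_isPrimitiveElliptic hp hq (Or.inl (trace_matA p))
    (Or.inl (trace_matB q ρ)) ?_ h
  rw [trace_commutator_matA_matB, axis]
  push_cast
  ring

open Filter Topology in
theorem tendsto_cos_pi_div_nat :
    Tendsto (fun n : ℕ => Real.cos (Real.pi / n)) atTop (𝓝 1) := by
  have := (Real.continuous_cos.tendsto 0).comp (tendsto_const_div_atTop_nhds_zero_nat Real.pi)
  rwa [Real.cos_zero] at this

open Filter Topology in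
theorem isCuspGroup_zero {p q : ℕ} (hq : 2 ≤ q)
    (hρ : ((2 + 2 * Real.cos (Real.pi / p - Real.pi / q) : ℝ) : ℂ) ∈ closedDeformationSpace p q) :
    IsCuspGroup p q ((2 + 2 * Real.cos (Real.pi / p - Real.pi / q) : ℝ) : ℂ) := by
  refine isCuspGroup_of_word hq hρ (FreeGroup.of 0 * (FreeGroup.of 1)⁻¹)
    (fun r => matA p * (matB q r)⁻¹) (fun r => by simp [toPSL_mul, toPSL_inv]) ?_ ?_
    (fun n => ((2 * Real.cos (Real.pi / n) + 2 * Real.cos (Real.pi / p - Real.pi / q) : ℝ) : ℂ))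
    ?_ (Eventually.of_forall fun n => ?_)
  · rw [trace_matA_mul_matB_inv]
    push_cast
    ring
  · have : (matA p * (matB q ((2 + 2 * Real.cos (Real.pi / p - Real.pi / q) : ℝ) : ℂ))⁻¹).val 0 1 =
        expPi q := by
      rw [Matrix.SpecialLinearGroup.coe_mul, Matrix.SpecialLinearGroup.coe_inv,
        Matrix.adjugate_fin_two]
      simp [matA, matB, Matrix.mul_apply, Fin.sum_univ_two, expPi]
    rw [this]
    exact expPi_ne_zero q
  · refine (Complex.continuous_ofReal.tendsto _).comp ?_
    simpa using (tendsto_cos_pi_div_nat.const_mul 2).add_const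
      (2 * Real.cos (Real.pi / p - Real.pi / q))
  · rw [trace_matA_mul_matB_inv]
    push_cast
    ring

open Filter Topology in
theorem isCuspGroup_one {p q : ℕ} (hq : 2 ≤ q)
    (hρ : ((-2 - 2 * Real.cos (Real.pi / p + Real.pi / q) : ℝ) : ℂ) ∈ closedDeformationSpace p q) :
    IsCuspGroup p q ((-2 - 2 * Real.cos (Real.pi / p + Real.pi / q) : ℝ) : ℂ) := by
  refine isCuspGroup_of_word hq hρ (FreeGroup.of 0 * FreeGroup.of 1)
    (fun r => matA p * matB q r) (fun r => by simp [toPSL_mul]) ?_ ?_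
    (fun n => ((-2 * Real.cos (Real.pi / n) - 2 * Real.cos (Real.pi / p + Real.pi / q) : ℝ) : ℂ))
    ?_ (Eventually.of_forall fun n => ?_)
  · rw [trace_matA_mul_matB]
    push_cast
    ring
  · have : (matA p * matB q ((-2 - 2 * Real.cos (Real.pi / p + Real.pi / q) : ℝ) : ℂ)).val 0 1 =
        (expPi q)⁻¹ := by
      rw [Matrix.SpecialLinearGroup.coe_mul]
      simp [matA, matB, Matrix.mul_apply, Fin.sum_univ_two, expPi]
    rw [this]
    exact inv_ne_zero (expPi_ne_zero q)
  · refine (Complex.continuous_ofReal.tendsto _).comp ?_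
    simpa using (tendsto_cos_pi_div_nat.const_mul (-2)).sub_const
      (2 * Real.cos (Real.pi / p + Real.pi / q))
  · rw [trace_matA_mul_matB]
    push_cast
    ring

theorem sin_pi_div_lt_one {n : ℕ} (hn : 3 ≤ n) : Real.sin (Real.pi / n) < 1 := by
  have := Real.sin_sq_add_cos_sq (Real.pi / n)
  have := cos_pi_div_pos hn
  nlinarith

/-- A vanishing entry would force ρ = α(β⁻¹ − β), with α = `expPi p` and β = `expPi q`, whose
modulus 2 sin(π/q) is less than 2. -/
theorem commutator_matA_matB_zero_one {p q : ℕ} (hq : 3 ≤ q) {ρ : ℂ}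
    (hρ : ρ.re ^ 2 + ρ.im ^ 2 = 4) :
    (matA p * matB q ρ * (matA p)⁻¹ * (matB q ρ)⁻¹).val 0 1 ≠ 0 := by
  intro h
  have ha := expPi_ne_zero p
  have hb := expPi_ne_zero q
  have h1 : expPi p * (1 - expPi q ^ 2) = ρ * expPi q := by
    rw [Matrix.SpecialLinearGroup.coe_mul, Matrix.SpecialLinearGroup.coe_mul,
      Matrix.SpecialLinearGroup.coe_mul, Matrix.SpecialLinearGroup.coe_inv,
      Matrix.SpecialLinearGroup.coe_inv, Matrix.adjugate_fin_two, Matrix.adjugate_fin_two] at h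
    change ((!![expPi p, 1; 0, (expPi p)⁻¹] * !![expPi q, 0; ρ, (expPi q)⁻¹] *
      !![(expPi p)⁻¹, -1; -0, expPi p] * !![(expPi q)⁻¹, -0; -ρ, expPi q] :
        Matrix (Fin 2) (Fin 2) ℂ)) 0 1 = 0 at h
    simp [Matrix.mul_apply, Fin.sum_univ_two] at h
    field_simp at h
    grind
  have h2 : ρ = expPi p * ((expPi q)⁻¹ - expPi q) := by
    field_simp
    linear_combination -h1
  have h3 : ‖ρ‖ = 2 * Real.sin (Real.pi / q) := by
    rw [h2, norm_mul, norm_expPi, one_mul, expPi_inv_eq, expPi_eq,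
      show ((Real.cos (Real.pi / q) : ℝ) : ℂ) - (Real.sin (Real.pi / q) : ℝ) * Complex.I -
        ((Real.cos (Real.pi / q) : ℝ) + (Real.sin (Real.pi / q) : ℝ) * Complex.I) =
        ((-(2 * Real.sin (Real.pi / q)) : ℝ) : ℂ) * Complex.I by push_cast; ring,
      norm_mul, Complex.norm_I, mul_one, Complex.norm_real, norm_neg, Real.norm_of_nonneg]
    have := sin_pi_div_pos (n := q) (by omega)
    positivity
  have h4 : ‖ρ‖ ^ 2 = 4 := by
    rw [← hρ, Complex.sq_norm, Complex.normSq_apply]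
    ring
  have := sin_pi_div_lt_one hq
  have := sin_pi_div_pos (n := q) (by omega)
  nlinarith

-- For ρ = m + iy the commutator trace is 2 − (m² + y²). It is −2 at the cusp because |ρ| = 2, and
-- −2 cos(π/n) at the heights chosen along the vertical axis.
open Filter Topology in
theorem isCuspGroup_half {p q : ℕ} (hp : 3 ≤ p) (hq : 3 ≤ q) {ε : ℝ} (hε : ε ^ 2 = 1)
    (hρ : (⟨axis p q, ε * halfHeight p q⟩ : ℂ) ∈ closedDeformationSpace p q) :
    IsCuspGroup p q ⟨axis p q, ε * halfHeight p q⟩ := by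
  have tr : ∀ y : ℝ, (matA p * matB q ⟨axis p q, ε * y⟩ * (matA p)⁻¹ *
      (matB q ⟨axis p q, ε * y⟩)⁻¹).val.trace = ((2 - (axis p q ^ 2 + y ^ 2) : ℝ) : ℂ) := by
    intro y
    rw [trace_commutator_matA_matB]
    apply Complex.ext
    · simp only [Complex.add_re, Complex.mul_re, Complex.sub_re, Complex.sub_im, Complex.ofReal_re,
        Complex.ofReal_im, Complex.re_ofNat]
      linear_combination -y ^ 2 * hε
    · simp only [Complex.add_im, Complex.mul_im, Complex.sub_re, Complex.sub_im, Complex.ofReal_re,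
        Complex.ofReal_im, Complex.im_ofNat]
      ring
  refine isCuspGroup_of_word (by omega) hρ
    (FreeGroup.of 0 * FreeGroup.of 1 * (FreeGroup.of 0)⁻¹ * (FreeGroup.of 1)⁻¹)
    (fun r => matA p * matB q r * (matA p)⁻¹ * (matB q r)⁻¹)
    (fun r => by simp [toPSL_mul, toPSL_inv]) ?_ (commutator_matA_matB_zero_one hq ?_)
    (fun n => ⟨axis p q, ε * √(2 + 2 * Real.cos (Real.pi / n) - axis p q ^ 2)⟩) ?_ ?_
  · rw [tr, halfHeight_sq]
    push_cast
    ring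
  · simp only [mul_pow, hε, halfHeight_sq]
    ring
  · have h1 : Tendsto (fun n : ℕ => 2 + 2 * Real.cos (Real.pi / n) - axis p q ^ 2) atTop
        (𝓝 (halfHeight p q ^ 2)) := by
      have := ((tendsto_cos_pi_div_nat.const_mul 2).const_add 2).sub_const (axis p q ^ 2)
      rw [halfHeight_sq]
      convert this using 2
      norm_num
    have h2 := (h1.sqrt).const_mul ε
    rw [Real.sqrt_sq (halfHeight_pos hp hq).le] at h2
    have h3 : Continuous fun y : ℝ => (⟨axis p q, y⟩ : ℂ) := by
      have : (fun y : ℝ => (⟨axis p q, y⟩ : ℂ)) = fun y : ℝ => (axis p q : ℂ) + y * Complex.I := by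
        ext y
        exact Complex.mk_eq_add_mul_I _ _
      rw [this]
      fun_prop
    exact (h3.tendsto _).comp h2
  · have h1 := tendsto_cos_pi_div_nat.eventually_const_lt (u := (axis p q ^ 2 - 2) / 2) (by
      have := halfHeight_sq (p := p) (q := q)
      have := halfHeight_pos hp hq
      nlinarith)
    filter_upwards [h1] with n hn
    rw [tr, Real.sq_sqrt (by linarith)]
    push_cast
    ring

/-! ### The cusps on the boundary of the polygon -/

theorem isOpen_Omega {p q : ℕ} (hp : 3 ≤ p) (hq : 3 ≤ q) : IsOpen (Omega p q) := by
  have : Omega p q = {z | z ∈ Omega p q} := rfl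
  rw [this]
  simp only [mem_Omega_iff hp hq, Set.ofPred_and]
  refine IsOpen.inter ?_ (IsOpen.inter ?_ (IsOpen.inter ?_ ?_)) <;>
    exact isOpen_lt (by fun_prop) (by fun_prop)

theorem mem_closure_Omega {p q : ℕ} (hp : 3 ≤ p) (hq : 3 ≤ q) {z : ℂ}
    (h1 : |z.re - axis p q| ≤ 2 + 2 * Real.cos (Real.pi / p - Real.pi / q) - axis p q)
    (h2 : |z.im| ≤ halfHeight p q)
    (h3 : (rhoStar p q).re * (axis p q + |z.re - axis p q|) + (rhoStar p q).im * |z.im| ≤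
      (rhoStar p q).re ^ 2 + (rhoStar p q).im ^ 2)
    (h4 : (rhoStar q p).re * (axis p q + |z.re - axis p q|) + (rhoStar q p).im * |z.im| ≤
      (rhoStar q p).re ^ 2 + (rhoStar q p).im ^ 2) : z ∈ closure (Omega p q) := by
  -- The half-open segment from the centre to z lies in the open polygon, since the centre satisfies
  -- all the inequalities strictly.
  have hc : Continuous fun t : ℝ => (axis p q : ℂ) + t * (z - axis p q) := by fun_prop
  have hz : (axis p q : ℂ) + (1 : ℝ) * (z - axis p q) = z := by push_cast; ring
  have h5 : (1 : ℝ) ∈ closure (Set.Ioo 0 1) := by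
    rw [closure_Ioo zero_ne_one]
    exact ⟨zero_le_one, le_rfl⟩
  rw [← hz]
  refine hc.closure_preimage_subset (Omega p q) (closure_mono ?_ h5)
  rintro t ⟨ht0, ht1⟩
  have ha := axis_lt hp hq
  have ha0 := axis_pos (p := p) (q := q) (by omega) (by omega)
  have e1 : |((axis p q : ℂ) + t * (z - axis p q)).re - axis p q| = t * |z.re - axis p q| := by
    simp [abs_mul, abs_of_pos ht0]
  have e2 : |((axis p q : ℂ) + t * (z - axis p q)).im| = t * |z.im| := by
    simp [abs_mul, abs_of_pos ht0]
  have key : ∀ {x y a b : ℝ}, a * (axis p q + x) + b * y ≤ a ^ 2 + b ^ 2 →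
      axis p q * a < a ^ 2 + b ^ 2 → a * (axis p q + t * x) + b * (t * y) < a ^ 2 + b ^ 2 := by
    intro x y a b h h'
    nlinarith [mul_le_mul_of_nonneg_left h ht0.le, mul_lt_mul_of_pos_left h' (sub_pos.mpr ht1)]
  rw [Set.mem_preimage, mem_Omega_iff hp hq, e1, e2]
  refine ⟨?_, ?_, key h3 (axis_mul_re_lt hp hq), key h4 ?_⟩
  · nlinarith
  · nlinarith [halfHeight_pos hp hq]
  · rw [axis_comm]
    exact axis_mul_re_lt hq hp

/-- The cusp at the top has modulus 2, so its inner product with s is at most (|s|² + 4)/2, and this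
is at most |s|². -/
theorem axis_mul_re_add_halfHeight_mul_im_le {p q : ℕ} {s : ℂ} (h : 4 ≤ s.re ^ 2 + s.im ^ 2) :
    s.re * axis p q + s.im * halfHeight p q ≤ s.re ^ 2 + s.im ^ 2 := by
  have h1 := halfHeight_sq (p := p) (q := q)
  nlinarith [sq_nonneg (s.re - axis p q), sq_nonneg (s.im - halfHeight p q)]

theorem mem_frontier_Omega_of_im_eq_zero {p q : ℕ} (hp : 3 ≤ p) (hq : 3 ≤ q) {z : ℂ}
    (h1 : |z.re - axis p q| = 2 + 2 * Real.cos (Real.pi / p - Real.pi / q) - axis p q)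
    (h2 : z.im = 0) : z ∈ frontier (Omega p q) := by
  rw [(isOpen_Omega hp hq).frontier_eq]
  refine ⟨mem_closure_Omega hp hq h1.le ?_ ?_ ?_, ?_⟩
  · rw [h2, abs_zero]
    exact (halfHeight_pos hp hq).le
  · rw [h1, h2, abs_zero, mul_zero, add_zero, add_sub_cancel, mul_comm]
    exact re_rhoStar_le
  · rw [h1, h2, abs_zero, mul_zero, add_zero, add_sub_cancel, mul_comm, ← Real.cos_neg, neg_sub]
    exact re_rhoStar_le
  · rw [mem_Omega_iff hp hq]
    exact fun h => h.1.ne h1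

theorem mem_frontier_Omega_of_re_eq_axis {p q : ℕ} (hp : 3 ≤ p) (hq : 3 ≤ q) {z : ℂ}
    (h1 : z.re = axis p q) (h2 : |z.im| = halfHeight p q) : z ∈ frontier (Omega p q) := by
  have ha := axis_lt hp hq
  have ha0 := axis_pos (p := p) (q := q) (by omega) (by omega)
  rw [(isOpen_Omega hp hq).frontier_eq]
  refine ⟨mem_closure_Omega hp hq ?_ h2.le ?_ ?_, ?_⟩
  · rw [h1, sub_self, abs_zero]
    linarith
  · rw [h1, h2, sub_self, abs_zero, add_zero]
    exact axis_mul_re_add_halfHeight_mul_im_le (four_le_normSq_rhoStar hp hq)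
  · rw [h1, h2, sub_self, abs_zero, add_zero]
    exact axis_mul_re_add_halfHeight_mul_im_le (four_le_normSq_rhoStar hq hp)
  · rw [mem_Omega_iff hp hq]
    exact fun h => h.2.1.ne h2

theorem two_mul_axis_sub (p q : ℕ) :
    2 * axis p q - (2 + 2 * Real.cos (Real.pi / p - Real.pi / q)) =
      -2 - 2 * Real.cos (Real.pi / p + Real.pi / q) := by
  rw [axis, Real.cos_add, Real.cos_sub]
  ring

theorem mem_frontier_Omega_of_mem_cuspPoints {p q : ℕ} (hp : 3 ≤ p) (hq : 3 ≤ q) {z : ℂ}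
    (hz : z ∈ cuspPoints p q) : z ∈ frontier (Omega p q) := by
  have ha := axis_lt hp hq
  have ha0 := axis_pos (p := p) (q := q) (by omega) (by omega)
  have hh := halfHeight_pos hp hq
  rcases hz with rfl | rfl | rfl | rfl
  · refine mem_frontier_Omega_of_im_eq_zero hp hq ?_ (Complex.ofReal_im _)
    rw [Complex.ofReal_re, abs_of_pos]
    linarith
  · refine mem_frontier_Omega_of_im_eq_zero hp hq ?_ (Complex.ofReal_im _)
    rw [Complex.ofReal_re, ← two_mul_axis_sub, abs_of_neg]
    · ring
    · linarith
  · exact mem_frontier_Omega_of_re_eq_axis hp hq rfl (abs_of_pos hh)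
  · exact mem_frontier_Omega_of_re_eq_axis hp hq rfl ((abs_neg _).trans (abs_of_pos hh))

theorem isCuspGroup_of_mem_cuspPoints {p q : ℕ} (hp : 3 ≤ p) (hq : 3 ≤ q) {z : ℂ}
    (hz : z ∈ cuspPoints p q) : IsCuspGroup p q z := by
  have h := mem_frontier_Omega_of_mem_cuspPoints hp hq hz
  rw [(isOpen_Omega hp hq).frontier_eq] at h
  have h1 := mem_closedDeformationSpace hp hq h.2
  rcases hz with rfl | rfl | rfl | rfl
  · exact isCuspGroup_zero (by omega) h1
  · exact isCuspGroup_one (by omega) h1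
  · have := isCuspGroup_half hp hq (ε := 1) (by norm_num)
    rw [one_mul] at this
    exact this h1
  · have := isCuspGroup_half hp hq (ε := -1) (by norm_num)
    rw [neg_one_mul] at this
    exact this h1

theorem ncard_cuspPoints {p q : ℕ} (hp : 3 ≤ p) (hq : 3 ≤ q) : (cuspPoints p q).ncard = 4 := by
  have ha := axis_lt hp hq
  have ha0 := axis_pos (p := p) (q := q) (by omega) (by omega)
  have hh := halfHeight_pos hp hq
  have e := two_mul_axis_sub p q
  have hne : ∀ {x y : ℝ}, y ≠ 0 → ((x : ℝ) : ℂ) ≠ ⟨axis p q, y⟩ := by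
    intro x y hy h
    exact hy (congrArg Complex.im h).symm
  change Set.ncard {_, _, (⟨axis p q, halfHeight p q⟩ : ℂ), ⟨axis p q, -halfHeight p q⟩} = 4
  rw [Set.ncard_insert_of_notMem, Set.ncard_insert_of_notMem, Set.ncard_pair]
  · intro h
    have := congrArg Complex.im h
    simp only at this
    linarith
  · rintro (h | h)
    · exact hne hh.ne' h
    · exact hne (neg_ne_zero.mpr hh.ne') h
  · rintro (h | h | h)
    · have := Complex.ofReal_injective h
      linarith
    · exact hne hh.ne' h
    · exact hne (neg_ne_zero.mpr hh.ne') h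

end

theorem theorem1p1 (p q : ℕ) (hp : 3 ≤ p) (hpq : p ≤ q) :
    (∀ X Y : SL(2, ℂ), IsPrimitiveElliptic p X → IsPrimitiveElliptic q Y →
      ∀ ρ : ℂ,
        ρ * (ρ - ((4 * Real.sin (Real.pi / p) * Real.sin (Real.pi / q) : ℝ) : ℂ)) =
          (X * Y * X⁻¹ * Y⁻¹).val.trace - 2 →
        ρ ∉ Omega p q →
        IsDiscreteGroup X Y ∧ IsFreeProduct X Y) ∧
    ((cuspPoints p q).ncard = 4 ∧
      ∀ ρ ∈ cuspPoints p q, ρ ∈ frontier (Omega p q) ∧ IsCuspGroup p q ρ) := by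
  have hq : 3 ≤ q := hp.trans hpq
  exact ⟨fun X Y hX hY ρ => isDiscreteGroup_and_isFreeProduct_of_isPrimitiveElliptic hp hq hX hY,
    ncard_cuspPoints hp hq, fun ρ hρ => ⟨mem_frontier_Omega_of_mem_cuspPoints hp hq hρ,
      isCuspGroup_of_mem_cuspPoints hp hq hρ⟩⟩
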